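/- Consider fully connected networks with $L=k+2\ge 2$ layers in the NTK parametrization, with input dimension $n_0\ge1$, all $L-1$ hidden layers of the same width $n\ge1$, and scalar output. On an input $x\in\mathbb R^{n_0}$ put $\alpha^{(0)}=x$, $$\tilde\alpha^{(\ell+1)}=\tfrac{1}{\sqrt{n_\ell}}W^{(\ell)}\alpha^{(\ell)}+\tau b^{(\ell)},\qquad \alpha^{(\ell)}=\sigma(\tilde\alpha^{(\ell)})\ (1\le \ell\le L-1),\qquad f(x,\theta)=\tilde\alpha^{(L)},$$ with $n_1=\dots=n_{L-1}=n$, $n_L=1$, where $\tau\in\mathbb R$, the activation $\sigma:\mathbb R\to\mathbb R$ acts coordinatewise and is Lipschitz and twice differentiable with bounded second derivative, and $\theta\in\mathbb R^d$ collects all entries of all $W^{(\ell)}$ and $b^{(\ell)}$, so that $d=n(n_0+1)+kn(n+1)+(n+1)$. Let $\theta_0$ have independent standard normal entries. Let $x_1,\dots,x_m\in\mathbb R^{n_0}$ ($m\ge1$) be inputs with labels $y_1,\dots,y_m$, and let $\ell(\cdot,\cdot)$ be a loss which in its first argument is $\beta$-Lipschitz and differentiable with $\gamma$-Lipschitz derivative.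 Let $\Theta_0=(\langle\nabla_\theta f(x_i,\theta_0),\nabla_\theta f(x_j,\theta_0)\rangle)_{i,j}$ be the NTK matrix at initialization, put $g_i=\nabla_\theta \ell(f(x_i,\theta_0),y_i)$ and let $H_i=\nabla^2_\theta \ell(f(x_i,\theta_0),y_i)$ be the Hessian ($H_i=0$ by convention if it does not exist). Define $$M_{\mathrm{Grad}}=\Big\|\tfrac1m\sum_i g_i\Big\|_2,\quad M_{\mathrm{SNIP}}=\Big|\tfrac1m\sum_i\theta_0^\top g_i\Big|,\quad M_{\mathrm{GraSP}}=\Big|\tfrac1m\sum_i\theta_0^\top H_ig_i\Big|,\quad M_{\mathrm{trace}}=\sqrt{\|\Theta_0\|_{\mathrm{tr}}/m},$$ where $\|\cdot\|_{\mathrm{tr}}$ is the trace norm (so $\|\Theta_0\|_{\mathrm{tr}}=\operatorname{tr}\Theta_0$, as $\Theta_0$ is positive semidefinite), and $R(\delta)=\sqrt{d+2\sqrt{d\log(1/\delta)}+2\log(1/\delta)}$. Then for every $\delta\in(0,1)$ there are constants $\rho_1,\rho_2>0$, depending only on $\delta,L,n_0,\sigma,\tau$ and the inputs $x_1,\dots,x_m$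 (not on the width $n$, the loss, $\beta$, $\gamma$ or the labels), such that for every width $n\ge1$, every loss as above and all labels: 1. $f(x_i,\cdot)$ and $\ell(f(x_i,\cdot),y_i)$ are differentiable at every $\theta$, and the Hessian of $\ell(f(x_i,\cdot),y_i)$ exists at every $\theta$ such that $\ell(\cdot,y_i)$ is twice differentiable at $f(x_i,\theta)$; 2. $M_{\mathrm{Grad}}\le\beta M_{\mathrm{trace}}$ for every $\theta_0$; 3. with probability at least $1-\delta$, $M_{\mathrm{SNIP}}\le\beta R(\delta)M_{\mathrm{trace}}$; 4. with probability at least $1-\delta$, simultaneously $M_{\mathrm{Grad}}\le\beta M_{\mathrm{trace}}$, $M_{\mathrm{SNIP}}\le\beta R(\delta/2)M_{\mathrm{trace}}$ and $M_{\mathrm{GraSP}}\le\beta(\gamma\rho_1^2+\beta\rho_2)R(\delta/2)M_{\mathrm{trace}}$. In particular, with high probability, $M_{\mathrm{Grad}},M_{\mathrm{SNIP}},M_{\mathrm{GraSP}}=O(M_{\mathrm{trace}})$. -/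

import Mathlib

open MeasureTheory ProbabilityTheory
open scoped NNReal Gradient

namespace TrainingFree

noncomputable section

/-! ### The network

A fully connected network with `L = k + 2` layers in the NTK parametrization: input dimension `n₀`,
`k + 1` hidden layers of common width `n`, scalar output, activation `σ`, and a factor `τ` in front
of the biases.  Each layer is the affine map `a ↦ (fan-in)^(-1/2) W a + τ b`. -/

/-- The coordinates of the parameter vector.  First summand: the layer `ℝ^{n₀} → ℝ^n`;
second summand: the `k` layers `ℝ^n → ℝ^n`; third summand: the output layer `ℝ^n → ℝ`.
In each of them `some j` is the weight on the `j`-th input of the layer and `none` is the bias. -/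
abbrev ParamIdx (n₀ n k : ℕ) : Type :=
  (Fin n × Option (Fin n₀)) ⊕ (Fin k × Fin n × Option (Fin n)) ⊕ Option (Fin n)

/-- The parameter space `ℝ^d` with its Euclidean norm. -/
abbrev Params (n₀ n k : ℕ) : Type := EuclideanSpace ℝ (ParamIdx n₀ n k)

/-- The number `d` of parameters. -/
abbrev numParams (n₀ n k : ℕ) : ℕ := Fintype.card (ParamIdx n₀ n k)

variable {n₀ n k m : ℕ}

/-- The activations of hidden layer `ℓ + 1`, for `ℓ = 0, …, k`, on the input `x`. -/
def act (σ : ℝ → ℝ) (τ : ℝ) (θ : Params n₀ n k) (x : EuclideanSpace ℝ (Fin n₀)) :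
    (ℓ : ℕ) → ℓ ≤ k → Fin n → ℝ
  | 0, _ => fun i =>
      σ ((√(n₀ : ℝ))⁻¹ * ∑ j : Fin n₀, θ (Sum.inl (i, some j)) * x j
          + τ * θ (Sum.inl (i, none)))
  | ℓ + 1, h => fun i =>
      σ ((√(n : ℝ))⁻¹ * ∑ j : Fin n, θ (Sum.inr (Sum.inl (⟨ℓ, h⟩, i, some j)))
            * act σ τ θ x ℓ (Nat.le_of_succ_le h) j
          + τ * θ (Sum.inr (Sum.inl (⟨ℓ, h⟩, i, none))))

/-- The scalar output `f(x, θ)` of the network. -/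
def net (σ : ℝ → ℝ) (τ : ℝ) (x : EuclideanSpace ℝ (Fin n₀)) (θ : Params n₀ n k) : ℝ :=
  (√(n : ℝ))⁻¹ * ∑ j : Fin n, θ (Sum.inr (Sum.inr (some j))) * act σ τ θ x k le_rfl j
    + τ * θ (Sum.inr (Sum.inr none))

/-- The outputs of the network on the inputs `x_1, …, x_m`, as functions of the parameters. -/
def model (σ : ℝ → ℝ) (τ : ℝ) (n k : ℕ) (x : Fin m → EuclideanSpace ℝ (Fin n₀)) (i : Fin m)
    (θ : Params n₀ n k) : ℝ :=
  net σ τ (x i) θ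

/-! ### The metrics, for an arbitrary parametrized scalar model on `m` samples -/

variable {ι Y : Type*} [Fintype ι]

/-- The trace norm of a square real matrix: the sum of its singular values. -/
def traceNorm (A : Matrix (Fin m) (Fin m) ℝ) : ℝ :=
  ∑ i : Fin m, (Matrix.toEuclideanLin A).singularValues i

/-- The NTK matrix `Θ i j = ⟨∇_θ f(x_i, θ), ∇_θ f(x_j, θ)⟩`; here `F i θ` is `f(x_i, θ)`. -/
def ntk (F : Fin m → EuclideanSpace ℝ ι → ℝ) (θ : EuclideanSpace ℝ ι) :
    Matrix (Fin m) (Fin m) ℝ :=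
  Matrix.of fun i j => inner ℝ (∇ (F i) θ) (∇ (F j) θ)

/-- `M_trace = √(‖Θ‖_tr / m)`. -/
def mTrace (F : Fin m → EuclideanSpace ℝ ι → ℝ) (θ : EuclideanSpace ℝ ι) : ℝ :=
  √(traceNorm (ntk F θ) / m)

/-- The loss on the `i`-th sample, `θ ↦ ℓ(f(x_i, θ), y_i)`. -/
def sampleLoss (loss : ℝ → Y → ℝ) (F : Fin m → EuclideanSpace ℝ ι → ℝ) (y : Fin m → Y)
    (i : Fin m) (θ : EuclideanSpace ℝ ι) : ℝ :=
  loss (F i θ) (y i)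

/-- The Hessian `H_i` of the `i`-th sample loss in `θ`, as an operator: the derivative of the
gradient (zero where the gradient is not differentiable). -/
def hess (loss : ℝ → Y → ℝ) (F : Fin m → EuclideanSpace ℝ ι → ℝ) (y : Fin m → Y)
    (i : Fin m) (θ : EuclideanSpace ℝ ι) : EuclideanSpace ℝ ι →L[ℝ] EuclideanSpace ℝ ι :=
  fderiv ℝ (∇ (sampleLoss loss F y i)) θ

/-- `M_Grad`. -/
def mGrad (loss : ℝ → Y → ℝ) (F : Fin m → EuclideanSpace ℝ ι → ℝ) (y : Fin m → Y)
    (θ : EuclideanSpace ℝ ι) : ℝ :=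
  ‖(1 / (m : ℝ)) • ∑ i : Fin m, ∇ (sampleLoss loss F y i) θ‖

/-- `M_SNIP`. -/
def mSNIP (loss : ℝ → Y → ℝ) (F : Fin m → EuclideanSpace ℝ ι → ℝ) (y : Fin m → Y)
    (θ : EuclideanSpace ℝ ι) : ℝ :=
  |(1 / (m : ℝ)) * ∑ i : Fin m, inner ℝ θ (∇ (sampleLoss loss F y i) θ)|

/-- `M_GraSP`. -/
def mGraSP (loss : ℝ → Y → ℝ) (F : Fin m → EuclideanSpace ℝ ι → ℝ) (y : Fin m → Y)
    (θ : EuclideanSpace ℝ ι) : ℝ :=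
  |(1 / (m : ℝ)) *
    ∑ i : Fin m, inner ℝ θ (hess loss F y i θ (∇ (sampleLoss loss F y i) θ))|

/-- The radius `√(d + 2 √(d log (1/δ)) + 2 log (1/δ))`. -/
def radius (d : ℕ) (δ : ℝ) : ℝ :=
  √(d + 2 * √(d * Real.log (1 / δ)) + 2 * Real.log (1 / δ))

end

end TrainingFree

/-! The gradient of a sample loss is `ℓ'(f) ∇f`, hence at most `β ‖∇f‖`, and by Cauchy–Schwarz the
mean of `‖∇f(x_i)‖` is at most `√(tr Θ / m)`. Since the trace of a matrix is at most its trace norm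
(`trace_le_traceNorm`), this is at most `M_trace`, which gives the bound on `M_Grad` and, after
pairing with `θ`, the bound `β ‖θ‖ M_trace` on `M_SNIP`. In the same way `M_GraSP` is at most
`β ‖θ‖ M_trace` times a bound on the operator norms of the Hessians. A Hessian is at most
`γ ‖∇f‖² + β ‖∇²f‖` (`norm_hess_le`), also at points where the loss has no second derivative. With
probability at least `1 - δ` the norm of the Gaussian parameter is at most `R(δ)`
(`measure_radius_lt_norm_le`).

What remains is to bound `‖∇f‖` and `‖∇²f‖` with high probability, uniformly in the width. This is
done by propagating, layer by layer, bounds on the first two derivatives of the vector of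
activations (`exists_bounds_actVec`, `exists_bounds_net`). They rest on two facts. The weight matrix
of a hidden layer, divided by `√n`, has bounded operator norm, whereas its derivative in the
parameter has norm at most `n ^ (-1/2)`, which compensates activations of norm `O(√n)`. The second
derivative of the coordinatewise activation is `(p, q) ↦ (σ''(v_i) p_i q_i)_i`, which is bounded on
Euclidean space independently of the dimension.

The operator norm of an `n × n` Gaussian matrix is `O(√n)` with exponentially small failure
probability (`measure_lt_norm_matAct_le`), and the norms of the other blocks of parameters are
bounded by the same `χ²` tail as the norm of `θ`. A union bound over the blocks of the parameter
gives `exists_wellScaled`. -/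

namespace TrainingFree

/-! ### The metrics of a twice differentiable scalar model -/

/-- In an orthonormal basis of eigenvectors `b i` of `Aᵀ A` the trace is the sum of the numbers
`⟨b i, A (b i)⟩`, and `‖A (b i)‖` is the `i`-th singular value. -/
theorem trace_le_traceNorm {m : ℕ} (A : Matrix (Fin m) (Fin m) ℝ) : A.trace ≤ traceNorm A := by
  set T := Matrix.toEuclideanLin A with hT
  have hn : Module.finrank ℝ (EuclideanSpace ℝ (Fin m)) = m := by simp
  set b := T.isSymmetric_adjoint_comp_self.eigenvectorBasis hn with hb
  have h1 : A.trace = LinearMap.trace ℝ _ T := by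
    rw [LinearMap.trace_eq_sum_inner T (EuclideanSpace.basisFun (Fin m) ℝ)]
    simp [Matrix.trace, hT, Matrix.toLpLin_apply, EuclideanSpace.inner_single_left]
  rw [h1, LinearMap.trace_eq_sum_inner T b]
  refine Finset.sum_le_sum fun i _ => ?_
  have h2 : ‖T (b i)‖ ^ 2 = T.singularValues i ^ 2 := by
    rw [T.sq_singularValues_fin hn, ← real_inner_self_eq_norm_sq, ← LinearMap.adjoint_inner_left,
      ← LinearMap.comp_apply]
    rw [hb, T.isSymmetric_adjoint_comp_self.apply_eigenvectorBasis hn]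
    simp [real_inner_smul_left]
  have h3 : ‖T (b i)‖ = T.singularValues i :=
    (sq_eq_sq₀ (norm_nonneg _) (T.singularValues_nonneg i)).1 h2
  calc inner ℝ (b i) (T (b i)) ≤ ‖b i‖ * ‖T (b i)‖ := real_inner_le_norm _ _
    _ = T.singularValues i := by rw [b.norm_eq_one, one_mul, h3]

theorem eventually_norm_sub_le {E G : Type*} [NormedAddCommGroup E] [NormedSpace ℝ E]
    [NormedAddCommGroup G] [NormedSpace ℝ G] {f : E → G} {a : E} (hf : DifferentiableAt ℝ f a)
    {C : ℝ} (hC : ‖fderiv ℝ f a‖ < C) : ∀ᶠ z in nhds a, ‖f z - f a‖ ≤ C * ‖z - a‖ := by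
  filter_upwards [hf.hasFDerivAt.isLittleO.def (sub_pos.2 hC)] with z hz
  calc ‖f z - f a‖ = ‖(f z - f a - fderiv ℝ f a (z - a)) + fderiv ℝ f a (z - a)‖ := by
        rw [sub_add_cancel]
    _ ≤ (C - ‖fderiv ℝ f a‖) * ‖z - a‖ + ‖fderiv ℝ f a‖ * ‖z - a‖ :=
        (norm_add_le _ _).trans (add_le_add hz (ContinuousLinearMap.le_opNorm _ _))
    _ = C * ‖z - a‖ := by ring

section Metrics

variable {m : ℕ} {ι Y : Type*} [Fintype ι] {F : Fin m → EuclideanSpace ℝ ι → ℝ}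
  {loss : ℝ → Y → ℝ} {β γ : ℝ≥0} {y : Fin m → Y} {θ : EuclideanSpace ℝ ι}

theorem mean_norm_gradient_le_mTrace (F : Fin m → EuclideanSpace ℝ ι → ℝ)
    (θ : EuclideanSpace ℝ ι) : (1 / (m : ℝ)) * ∑ i, ‖∇ (F i) θ‖ ≤ mTrace F θ := by
  refine Real.le_sqrt_of_sq_le ?_
  have h1 : ∑ i, ‖∇ (F i) θ‖ ^ 2 ≤ traceNorm (ntk F θ) := by
    refine le_trans (le_of_eq ?_) (trace_le_traceNorm _)
    simp only [Matrix.trace, Matrix.diag_apply, ntk, Matrix.of_apply, real_inner_self_eq_norm_sq]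
  have h2 := sq_sum_le_card_mul_sum_sq (s := Finset.univ) (f := fun i => ‖∇ (F i) θ‖)
  rw [Finset.card_univ, Fintype.card_fin] at h2
  rcases Nat.eq_zero_or_pos m with rfl | hm
  · simp
  have hm' : (0 : ℝ) < m := by exact_mod_cast hm
  rw [mul_pow, div_pow, one_pow, one_div_mul_eq_div, div_le_div_iff₀ (by positivity) hm']
  nlinarith

theorem sampleLoss_hasGradientAt (hl : Differentiable ℝ (fun u => loss u (y i)))
    (hF : DifferentiableAt ℝ (F i) θ) :
    HasGradientAt (sampleLoss loss F y i)
      (deriv (fun u => loss u (y i)) (F i θ) • ∇ (F i) θ) θ := by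
  have h := (hl (F i θ)).hasDerivAt.comp_hasFDerivAt θ hF.hasGradientAt.hasFDerivAt
  rw [hasGradientAt_iff_hasFDerivAt, map_smul]
  exact h

theorem gradient_sampleLoss (hl : Differentiable ℝ (fun u => loss u (y i)))
    (hF : Differentiable ℝ (F i)) :
    ∇ (sampleLoss loss F y i) =
      fun θ => deriv (fun u => loss u (y i)) (F i θ) • ∇ (F i) θ :=
  funext fun θ => (sampleLoss_hasGradientAt hl (hF θ)).gradient

theorem abs_deriv_loss_le (hlip : ∀ y, LipschitzWith β (fun u => loss u y)) (u : ℝ) (y : Y) :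
    |deriv (fun u => loss u y) u| ≤ β := by
  simpa using norm_deriv_le_of_lipschitz (hlip y) (x₀ := u)

theorem norm_gradient_sampleLoss_le (hlip : ∀ y, LipschitzWith β (fun u => loss u y))
    (hl : ∀ y, Differentiable ℝ (fun u => loss u y)) (hF : ∀ i, Differentiable ℝ (F i))
    (i : Fin m) (θ : EuclideanSpace ℝ ι) :
    ‖∇ (sampleLoss loss F y i) θ‖ ≤ β * ‖∇ (F i) θ‖ := by
  rw [gradient_sampleLoss (hl _) (hF i), norm_smul]
  gcongr
  exact abs_deriv_loss_le hlip _ _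

theorem mean_norm_gradient_sampleLoss_le (hlip : ∀ y, LipschitzWith β (fun u => loss u y))
    (hl : ∀ y, Differentiable ℝ (fun u => loss u y)) (hF : ∀ i, Differentiable ℝ (F i))
    (y : Fin m → Y) (θ : EuclideanSpace ℝ ι) :
    (1 / (m : ℝ)) * ∑ i, ‖∇ (sampleLoss loss F y i) θ‖ ≤ β * mTrace F θ := by
  calc (1 / (m : ℝ)) * ∑ i, ‖∇ (sampleLoss loss F y i) θ‖
      ≤ (1 / (m : ℝ)) * ∑ i, β * ‖∇ (F i) θ‖ := by
        gcongr with i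
        exact norm_gradient_sampleLoss_le hlip hl hF i θ
    _ = β * ((1 / (m : ℝ)) * ∑ i, ‖∇ (F i) θ‖) := by rw [← Finset.mul_sum]; ring
    _ ≤ β * mTrace F θ := by gcongr; exact mean_norm_gradient_le_mTrace F θ

theorem mGrad_le (hlip : ∀ y, LipschitzWith β (fun u => loss u y))
    (hl : ∀ y, Differentiable ℝ (fun u => loss u y)) (hF : ∀ i, Differentiable ℝ (F i))
    (y : Fin m → Y) (θ : EuclideanSpace ℝ ι) :
    mGrad loss F y θ ≤ β * mTrace F θ := by
  refine le_trans ?_ (mean_norm_gradient_sampleLoss_le hlip hl hF y θ)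
  rw [mGrad, norm_smul, Real.norm_of_nonneg (by positivity)]
  gcongr
  exact norm_sum_le _ _

/-- Both `mSNIP` and `mGraSP` are means of pairings `⟨θ, Tᵢ gᵢ⟩` of the parameter with an operator
applied to the loss gradient; such a mean is controlled by the size of the operators. -/
theorem abs_mean_inner_le (hlip : ∀ y, LipschitzWith β (fun u => loss u y))
    (hl : ∀ y, Differentiable ℝ (fun u => loss u y)) (hF : ∀ i, Differentiable ℝ (F i))
    {v : Fin m → EuclideanSpace ℝ ι} {r c : ℝ} (hθ : ‖θ‖ ≤ r) (hc : 0 ≤ c)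
    (hv : ∀ i, ‖v i‖ ≤ c * ‖∇ (sampleLoss loss F y i) θ‖) :
    |(1 / (m : ℝ)) * ∑ i, inner ℝ θ (v i)| ≤ β * c * r * mTrace F θ := by
  have hr : 0 ≤ r := (norm_nonneg _).trans hθ
  rw [abs_mul, abs_of_nonneg (by positivity : (0 : ℝ) ≤ 1 / m)]
  calc (1 / (m : ℝ)) * |∑ i, inner ℝ θ (v i)|
      ≤ (1 / (m : ℝ)) * ∑ i, r * (c * ‖∇ (sampleLoss loss F y i) θ‖) := by
        gcongr
        refine (Finset.abs_sum_le_sum_abs _ _).trans (Finset.sum_le_sum fun i _ => ?_)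
        exact (abs_real_inner_le_norm _ _).trans
          (mul_le_mul hθ (hv i) (norm_nonneg _) hr)
    _ = c * r * ((1 / (m : ℝ)) * ∑ i, ‖∇ (sampleLoss loss F y i) θ‖) := by
        rw [← Finset.mul_sum, ← Finset.mul_sum]; ring
    _ ≤ c * r * (β * mTrace F θ) := by
        have hcr : 0 ≤ c * r := mul_nonneg hc hr
        exact mul_le_mul_of_nonneg_left (mean_norm_gradient_sampleLoss_le hlip hl hF y θ) hcr
    _ = β * c * r * mTrace F θ := by ring

theorem mSNIP_le (hlip : ∀ y, LipschitzWith β (fun u => loss u y))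
    (hl : ∀ y, Differentiable ℝ (fun u => loss u y)) (hF : ∀ i, Differentiable ℝ (F i))
    (y : Fin m → Y) {r : ℝ} (hθ : ‖θ‖ ≤ r) :
    mSNIP loss F y θ ≤ β * r * mTrace F θ := by
  have h := abs_mean_inner_le (v := fun i => ∇ (sampleLoss loss F y i) θ) hlip hl hF hθ
    zero_le_one (fun i => (one_mul _).ge)
  rwa [mul_one] at h

theorem differentiableAt_gradient_sampleLoss {i : Fin m}
    (hl : ∀ y, Differentiable ℝ (fun u => loss u y))
    (hF : ∀ i, Differentiable ℝ (F i)) (hF' : DifferentiableAt ℝ (∇ (F i)) θ)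
    (h : DifferentiableAt ℝ (deriv (fun u => loss u (y i))) (F i θ)) :
    DifferentiableAt ℝ (∇ (sampleLoss loss F y i)) θ := by
  rw [gradient_sampleLoss (hl _) (hF i)]
  exact (h.comp θ (hF i θ)).smul hF'

/-- The Hessian of a sample loss is bounded even where the second derivative of the loss does not
exist: the increments of `ℓ'(f) ∇f` at `θ` are at most `γ ρ₁² + β ρ₂` times those of the parameter
in the limit. -/
theorem norm_hess_le (hlip : ∀ y, LipschitzWith β (fun u => loss u y))
    (hl : ∀ y, Differentiable ℝ (fun u => loss u y))
    (hl' : ∀ y, LipschitzWith γ (deriv (fun u => loss u y)))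
    (hF : ∀ i, Differentiable ℝ (F i)) {i : Fin m} (hF' : DifferentiableAt ℝ (∇ (F i)) θ)
    {ρ₁ ρ₂ : ℝ} (h₁ : ‖∇ (F i) θ‖ < ρ₁) (h₂ : ‖fderiv ℝ (∇ (F i)) θ‖ < ρ₂) :
    ‖hess loss F y i θ‖ ≤ γ * ρ₁ ^ 2 + β * ρ₂ := by
  have hρ₁ : 0 ≤ ρ₁ := (norm_nonneg _).trans h₁.le
  have hρ₂ : 0 ≤ ρ₂ := (norm_nonneg _).trans h₂.le
  refine norm_fderiv_le_of_lip' ℝ (by positivity) ?_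
  rw [gradient_sampleLoss (hl _) (hF i)]
  have e₁ : ∀ᶠ z in nhds θ, ‖∇ (F i) z‖ ≤ ρ₁ :=
    (hF'.continuousAt.norm.eventually_lt continuousAt_const h₁).mono fun _ h => h.le
  have e₂ : ∀ᶠ z in nhds θ, ‖F i z - F i θ‖ ≤ ρ₁ * ‖z - θ‖ := by
    have hg : ‖fderiv ℝ (F i) θ‖ < ρ₁ := by
      rwa [(hF i θ).hasGradientAt.hasFDerivAt.fderiv, LinearIsometryEquiv.norm_map]
    exact eventually_norm_sub_le (hF i θ) hg
  have e₃ : ∀ᶠ z in nhds θ, ‖∇ (F i) z - ∇ (F i) θ‖ ≤ ρ₂ * ‖z - θ‖ :=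
    eventually_norm_sub_le hF' h₂
  filter_upwards [e₁, e₂, e₃] with z z₁ z₂ z₃
  set D := deriv (fun u => loss u (y i))
  have hD : ‖D (F i z) - D (F i θ)‖ ≤ γ * (ρ₁ * ‖z - θ‖) :=
    ((hl' (y i)).norm_sub_le _ _).trans (by gcongr)
  calc ‖D (F i z) • ∇ (F i) z - D (F i θ) • ∇ (F i) θ‖
      = ‖(D (F i z) - D (F i θ)) • ∇ (F i) z + D (F i θ) • (∇ (F i) z - ∇ (F i) θ)‖ := by
        congr 1; module
    _ ≤ ‖D (F i z) - D (F i θ)‖ * ‖∇ (F i) z‖ + ‖D (F i θ)‖ * ‖∇ (F i) z - ∇ (F i) θ‖ := by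
        refine (norm_add_le _ _).trans ?_
        rw [norm_smul, norm_smul]
    _ ≤ γ * (ρ₁ * ‖z - θ‖) * ρ₁ + β * (ρ₂ * ‖z - θ‖) := by
        gcongr
        exact abs_deriv_loss_le hlip _ _
    _ = (γ * ρ₁ ^ 2 + β * ρ₂) * ‖z - θ‖ := by ring

theorem mGraSP_le (hlip : ∀ y, LipschitzWith β (fun u => loss u y))
    (hl : ∀ y, Differentiable ℝ (fun u => loss u y))
    (hl' : ∀ y, LipschitzWith γ (deriv (fun u => loss u y)))
    (hF : ∀ i, Differentiable ℝ (F i)) (hF' : ∀ i, DifferentiableAt ℝ (∇ (F i)) θ)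
    (y : Fin m → Y) {ρ₁ ρ₂ r : ℝ} (hρ₂ : 0 ≤ ρ₂) (h₁ : ∀ i, ‖∇ (F i) θ‖ < ρ₁)
    (h₂ : ∀ i, ‖fderiv ℝ (∇ (F i)) θ‖ < ρ₂) (hθ : ‖θ‖ ≤ r) :
    mGraSP loss F y θ ≤ β * (γ * ρ₁ ^ 2 + β * ρ₂) * r * mTrace F θ :=
  abs_mean_inner_le hlip hl hF hθ (by positivity) fun i =>
    (ContinuousLinearMap.le_opNorm _ _).trans
      (by gcongr; exact norm_hess_le hlip hl hl' hF (hF' i) (h₁ i) (h₂ i))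

end Metrics

/-! ### Twice differentiable maps with bounded derivatives at a point -/

section Jets

variable {E G H : Type*} [NormedAddCommGroup E] [NormedSpace ℝ E] [NormedAddCommGroup G]
  [NormedSpace ℝ G] [NormedAddCommGroup H] [NormedSpace ℝ H]

/-- `F` is twice differentiable everywhere, and at the point `θ` its first and second derivatives
have operator norms at most `a₁` and `a₂`. Continuity of the second derivative is not required,
as the activation need not be `C²`. -/
structure BoundedJet (F : E → G) (θ : E) (a₁ a₂ : ℝ) : Prop where
  diff : Differentiable ℝ F
  diff_fderiv : Differentiable ℝ (fderiv ℝ F)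
  norm_fderiv_le : ‖fderiv ℝ F θ‖ ≤ a₁
  norm_fderiv_fderiv_le : ‖fderiv ℝ (fderiv ℝ F) θ‖ ≤ a₂

theorem BoundedJet.nonneg₁ {F : E → G} {θ : E} {a₁ a₂ : ℝ} (h : BoundedJet F θ a₁ a₂) : 0 ≤ a₁ :=
  (norm_nonneg _).trans h.norm_fderiv_le

theorem BoundedJet.nonneg₂ {F : E → G} {θ : E} {a₁ a₂ : ℝ} (h : BoundedJet F θ a₁ a₂) : 0 ≤ a₂ :=
  (norm_nonneg (fderiv ℝ (fderiv ℝ F) θ)).trans h.norm_fderiv_fderiv_le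

theorem BoundedJet.mono {F : E → G} {θ : E} {a₁ a₂ b₁ b₂ : ℝ} (h : BoundedJet F θ a₁ a₂)
    (h₁ : a₁ ≤ b₁) (h₂ : a₂ ≤ b₂) : BoundedJet F θ b₁ b₂ :=
  ⟨h.diff, h.diff_fderiv, h.norm_fderiv_le.trans h₁, h.norm_fderiv_fderiv_le.trans h₂⟩

theorem BoundedJet.const (c : G) (θ : E) : BoundedJet (fun _ : E => c) θ 0 0 where
  diff := by fun_prop
  diff_fderiv := by simp
  norm_fderiv_le := by simp
  norm_fderiv_fderiv_le := by
    rw [show fderiv ℝ (fun _ : E => c) = fun _ => 0 from funext fun _ => fderiv_const_apply c,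
      fderiv_const_apply]
    exact (norm_zero (E := E →L[ℝ] E →L[ℝ] G)).le

/-- A layer whose weights `L θ` and biases `b θ` depend linearly on the parameter. The operator
norm of the weight `L θ` and that of the parametrization `L` enter separately: in the network the
former is bounded while the latter is of order `n ^ (-1/2)`. -/
theorem BoundedJet.affine_layer {F : E → H} {θ : E} {a₁ a₂ : ℝ} (hF : BoundedJet F θ a₁ a₂)
    (L : E →L[ℝ] H →L[ℝ] G) (b : E →L[ℝ] G) {c C R t : ℝ} (hL : ‖L‖ ≤ c) (hLθ : ‖L θ‖ ≤ C)
    (hR : ‖F θ‖ ≤ R) (hb : ‖b‖ ≤ t) :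
    BoundedJet (fun θ => L θ (F θ) + b θ) θ (c * R + C * a₁ + t) (2 * c * a₁ + C * a₂) := by
  have d₁ : ∀ z, HasFDerivAt (fun θ => L θ (F θ) + b θ)
      ((L z).comp (fderiv ℝ F z) + L.flip (F z) + b) z := fun z =>
    (L.hasFDerivAt.clm_apply (hF.diff z).hasFDerivAt).add b.hasFDerivAt
  have e₁ : fderiv ℝ (fun θ => L θ (F θ) + b θ) =
      fun z => (L z).comp (fderiv ℝ F z) + L.flip (F z) + b := funext fun z => (d₁ z).fderiv
  have d₂ : ∀ z, HasFDerivAt (fun z => (L z).comp (fderiv ℝ F z) + L.flip (F z) + b)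
      ((ContinuousLinearMap.compL ℝ E H G (L z)).comp (fderiv ℝ (fderiv ℝ F) z) +
        ((ContinuousLinearMap.compL ℝ E H G).flip (fderiv ℝ F z)).comp L +
        L.flip.comp (fderiv ℝ F z)) z := fun z =>
    ((L.hasFDerivAt.clm_comp (hF.diff_fderiv z).hasFDerivAt).add
      (L.flip.hasFDerivAt.comp z (hF.diff z).hasFDerivAt)).add_const b
  have hc : 0 ≤ c := (norm_nonneg L).trans hL
  have hC : 0 ≤ C := (norm_nonneg _).trans hLθ
  have h₁ := hF.nonneg₁
  have h₂ := hF.nonneg₂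
  have hR0 : 0 ≤ R := (norm_nonneg _).trans hR
  refine ⟨fun z => (d₁ z).differentiableAt, ?_, ?_, ?_⟩
  · rw [e₁]
    exact fun z => (d₂ z).differentiableAt
  · rw [e₁]
    calc ‖(L θ).comp (fderiv ℝ F θ) + L.flip (F θ) + b‖
        ≤ ‖L θ‖ * ‖fderiv ℝ F θ‖ + ‖L.flip‖ * ‖F θ‖ + ‖b‖ :=
          (norm_add₃_le).trans (by
            gcongr
            · exact ContinuousLinearMap.opNorm_comp_le _ _
            · exact ContinuousLinearMap.le_opNorm _ _)
      _ ≤ C * a₁ + c * R + t := by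
          rw [ContinuousLinearMap.opNorm_flip]
          have := hF.norm_fderiv_le
          gcongr
      _ = _ := by ring
  · rw [e₁, (d₂ θ).fderiv]
    refine ContinuousLinearMap.opNorm_le_bound _ (by positivity) fun u => ?_
    refine ContinuousLinearMap.opNorm_le_bound _ (by positivity) fun v => ?_
    have k₁ : ∀ w, ‖fderiv ℝ F θ w‖ ≤ a₁ * ‖w‖ :=
      fun w => ContinuousLinearMap.le_of_opNorm_le _ hF.norm_fderiv_le w
    have k₂ : ‖fderiv ℝ (fderiv ℝ F) θ u v‖ ≤ a₂ * ‖u‖ * ‖v‖ :=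
      ContinuousLinearMap.le_of_opNorm_le _
        (ContinuousLinearMap.le_of_opNorm_le _ hF.norm_fderiv_fderiv_le u) v
    have k₃ : ∀ w h, ‖L w h‖ ≤ c * ‖w‖ * ‖h‖ := fun w h =>
      ContinuousLinearMap.le_of_opNorm_le _ (ContinuousLinearMap.le_of_opNorm_le _ hL w) h
    calc ‖L θ (fderiv ℝ (fderiv ℝ F) θ u v) + L u (fderiv ℝ F θ v) + L v (fderiv ℝ F θ u)‖
        ≤ C * (a₂ * ‖u‖ * ‖v‖) + c * ‖u‖ * (a₁ * ‖v‖) + c * ‖v‖ * (a₁ * ‖u‖) := by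
          refine (norm_add₃_le).trans (add_le_add_three ?_ ?_ ?_)
          · exact (ContinuousLinearMap.le_of_opNorm_le _ hLθ _).trans (by gcongr)
          · exact (k₃ _ _).trans (by gcongr; exact k₁ v)
          · exact (k₃ _ _).trans (by gcongr; exact k₁ u)
      _ = (2 * c * a₁ + C * a₂) * ‖u‖ * ‖v‖ := by ring

end Jets

section Coordinatewise

variable {κ : Type*}

/-- The map applying the scalar function `s` to every coordinate. -/
noncomputable def coordwise (s : ℝ → ℝ) (v : EuclideanSpace ℝ κ) : EuclideanSpace ℝ κ :=
  WithLp.toLp 2 fun i => s (v i)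

@[simp] theorem coordwise_apply (s : ℝ → ℝ) (v : EuclideanSpace ℝ κ) (i : κ) :
    coordwise s v i = s (v i) := rfl

variable [Fintype κ]

theorem norm_le_mul_of_abs_le {u v : EuclideanSpace ℝ κ} {c : ℝ} (hc : 0 ≤ c)
    (h : ∀ i, |u i| ≤ c * |v i|) : ‖u‖ ≤ c * ‖v‖ := by
  refine le_of_sq_le_sq ?_ (by positivity)
  rw [mul_pow, EuclideanSpace.real_norm_sq_eq, EuclideanSpace.real_norm_sq_eq, Finset.mul_sum]
  refine Finset.sum_le_sum fun i _ => ?_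
  rw [← sq_abs (u i), ← sq_abs (v i), ← mul_pow]
  exact pow_le_pow_left₀ (abs_nonneg _) (h i) 2

/-- Coordinatewise multiplication `(c, p) ↦ (cᵢ pᵢ)ᵢ`. It is bounded because the sup norm is at
most the Euclidean norm. -/
noncomputable def diagMul :
    EuclideanSpace ℝ κ →L[ℝ] EuclideanSpace ℝ κ →L[ℝ] EuclideanSpace ℝ κ :=
  LinearMap.mkContinuous₂
    (LinearMap.mk₂ ℝ (fun c p => WithLp.toLp 2 fun i => c i * p i)
      (fun _ _ _ => by ext; simp [add_mul]) (fun _ _ _ => by ext; simp [mul_assoc])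
      (fun _ _ _ => by ext; simp [mul_add]) (fun _ _ _ => by ext; simp [mul_left_comm])) 1
    (fun c p => by
      rw [one_mul]
      refine norm_le_mul_of_abs_le (norm_nonneg _) fun i => ?_
      rw [LinearMap.mk₂_apply, abs_mul]
      gcongr
      exact PiLp.norm_apply_le c i)

@[simp] theorem diagMul_apply (c p : EuclideanSpace ℝ κ) (i : κ) :
    diagMul c p i = c i * p i := rfl

theorem norm_diagMul_le (c p : EuclideanSpace ℝ κ) : ‖diagMul c p‖ ≤ ‖c‖ * ‖p‖ :=
  norm_le_mul_of_abs_le (norm_nonneg _) fun i => by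
    rw [diagMul_apply, abs_mul]
    gcongr
    exact PiLp.norm_apply_le c i

theorem norm_diagMul_le_of_abs_le {c : EuclideanSpace ℝ κ} {K : ℝ} (hK : 0 ≤ K)
    (h : ∀ i, |c i| ≤ K) (p : EuclideanSpace ℝ κ) : ‖diagMul c p‖ ≤ K * ‖p‖ :=
  norm_le_mul_of_abs_le hK fun i => by
    rw [diagMul_apply, abs_mul]
    gcongr
    exact h i

theorem hasFDerivAt_coordwise {s : ℝ → ℝ} (hs : Differentiable ℝ s) (v : EuclideanSpace ℝ κ) :
    HasFDerivAt (coordwise s) (diagMul (coordwise (deriv s) v)) v := by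
  rw [← hasFDerivWithinAt_univ, hasFDerivWithinAt_euclidean]
  intro i
  rw [hasFDerivWithinAt_univ]
  have h := (hs (v i)).hasDerivAt.comp_hasFDerivAt v (EuclideanSpace.proj (𝕜 := ℝ) i).hasFDerivAt
  refine h.congr_fderiv ?_
  ext p
  simp

theorem norm_coordwise_le {s : ℝ → ℝ} {K : ℝ≥0} (hs : LipschitzWith K s)
    (v : EuclideanSpace ℝ κ) :
    ‖coordwise s v‖ ≤ |s 0| * √(Fintype.card κ) + K * ‖v‖ := by
  have h0 : ‖coordwise s (0 : EuclideanSpace ℝ κ)‖ ≤ |s 0| * √(Fintype.card κ) := by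
    rw [EuclideanSpace.norm_eq]
    simp [Real.sqrt_sq_eq_abs, mul_comm]
  have h1 : ‖coordwise s v - coordwise s 0‖ ≤ K * ‖v‖ :=
    norm_le_mul_of_abs_le K.2 fun i => by simpa using hs.norm_sub_le (v i) 0
  calc ‖coordwise s v‖ = ‖coordwise s 0 + (coordwise s v - coordwise s 0)‖ := by
        rw [add_sub_cancel]
    _ ≤ _ := (norm_add_le _ _).trans (add_le_add h0 h1)

/-- The second derivative of the coordinatewise activation at `v`, applied to `p` and `q`, is
`(σ''(vᵢ) pᵢ qᵢ)ᵢ`, whose Euclidean norm is at most `B ‖p‖ ‖q‖`, whatever the dimension. -/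
theorem BoundedJet.coordwise_comp {E : Type*} [NormedAddCommGroup E] [NormedSpace ℝ E]
    {F : E → EuclideanSpace ℝ κ} {θ : E} {a₁ a₂ : ℝ} (hF : BoundedJet F θ a₁ a₂)
    {σ : ℝ → ℝ} {K : ℝ≥0} {B : ℝ} (hσ_lip : LipschitzWith K σ) (hσ : Differentiable ℝ σ)
    (hσ' : Differentiable ℝ (deriv σ)) (hB : ∀ z, |deriv (deriv σ) z| ≤ B) :
    BoundedJet (fun θ => coordwise σ (F θ)) θ (K * a₁) (B * a₁ ^ 2 + K * a₂) := by
  have d₁ : ∀ z, HasFDerivAt (fun θ => coordwise σ (F θ))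
      ((diagMul (coordwise (deriv σ) (F z))).comp (fderiv ℝ F z)) z := fun z =>
    (hasFDerivAt_coordwise hσ (F z)).comp z (hF.diff z).hasFDerivAt
  have e₁ : fderiv ℝ (fun θ => coordwise σ (F θ)) =
      fun z => (diagMul (coordwise (deriv σ) (F z))).comp (fderiv ℝ F z) :=
    funext fun z => (d₁ z).fderiv
  have d₀ : ∀ z, HasFDerivAt (fun z => diagMul (coordwise (deriv σ) (F z)))
      (diagMul.comp ((diagMul (coordwise (deriv (deriv σ)) (F z))).comp (fderiv ℝ F z))) z :=
    fun z => (diagMul (κ := κ)).hasFDerivAt.comp z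
      ((hasFDerivAt_coordwise hσ' (F z)).comp z (hF.diff z).hasFDerivAt)
  have d₂ := fun z => (d₀ z).clm_comp (hF.diff_fderiv z).hasFDerivAt
  have hB0 : 0 ≤ B := (abs_nonneg _).trans (hB 0)
  have h₁ := hF.nonneg₁
  have h₂ := hF.nonneg₂
  have k₁ : ∀ w, ‖fderiv ℝ F θ w‖ ≤ a₁ * ‖w‖ :=
    fun w => ContinuousLinearMap.le_of_opNorm_le _ hF.norm_fderiv_le w
  have kσ : ∀ p, ‖diagMul (coordwise (deriv σ) (F θ)) p‖ ≤ K * ‖p‖ := fun p =>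
    norm_diagMul_le_of_abs_le K.2
      (fun i => by simpa using norm_deriv_le_of_lipschitz hσ_lip (x₀ := F θ i)) p
  refine ⟨fun z => (d₁ z).differentiableAt, ?_, ?_, ?_⟩
  · rw [e₁]
    exact fun z => (d₂ z).differentiableAt
  · rw [e₁]
    refine ContinuousLinearMap.opNorm_le_bound _ (by positivity) fun u => ?_
    refine (kσ _).trans ?_
    rw [mul_assoc]
    gcongr
    exact k₁ u
  · rw [e₁, (d₂ θ).fderiv]
    refine ContinuousLinearMap.opNorm_le_bound _ (by positivity) fun u => ?_
    refine ContinuousLinearMap.opNorm_le_bound _ (by positivity) fun v => ?_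
    have k₂ : ‖fderiv ℝ (fderiv ℝ F) θ u v‖ ≤ a₂ * ‖u‖ * ‖v‖ :=
      ContinuousLinearMap.le_of_opNorm_le _
        (ContinuousLinearMap.le_of_opNorm_le _ hF.norm_fderiv_fderiv_le u) v
    calc ‖diagMul (coordwise (deriv σ) (F θ)) (fderiv ℝ (fderiv ℝ F) θ u v) +
          diagMul (diagMul (coordwise (deriv (deriv σ)) (F θ)) (fderiv ℝ F θ u))
            (fderiv ℝ F θ v)‖
        ≤ K * (a₂ * ‖u‖ * ‖v‖) + (B * (a₁ * ‖u‖)) * (a₁ * ‖v‖) := by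
          refine (norm_add_le _ _).trans (add_le_add ((kσ _).trans (by gcongr)) ?_)
          refine (norm_diagMul_le _ _).trans ?_
          gcongr
          · refine (norm_diagMul_le_of_abs_le hB0 (fun i => hB _) _).trans ?_
            gcongr
            exact k₁ u
          · exact k₁ v
      _ = (B * a₁ ^ 2 + K * a₂) * ‖u‖ * ‖v‖ := by ring

end Coordinatewise

/-! ### Linear functions of the parameter -/

section Coordinates

variable {ι κ κ' : Type*} [Fintype ι] [Fintype κ] [Fintype κ']

/-- The block of coordinates of a vector that is selected by the injection `e`. -/
noncomputable def block (e : κ ↪ ι) : EuclideanSpace ℝ ι →L[ℝ] EuclideanSpace ℝ κ :=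
  LinearMap.mkContinuous
    { toFun := fun θ => WithLp.toLp 2 fun j => θ (e j)
      map_add' := fun _ _ => rfl
      map_smul' := fun _ _ => rfl } 1
    (fun θ => by
      rw [one_mul]
      refine le_of_sq_le_sq ?_ (norm_nonneg _)
      rw [EuclideanSpace.real_norm_sq_eq, EuclideanSpace.real_norm_sq_eq]
      have h := Finset.sum_map Finset.univ e (fun i => θ i ^ 2)
      exact h.symm.trans_le
        (Finset.sum_le_sum_of_subset_of_nonneg (Finset.subset_univ _) fun _ _ _ => sq_nonneg _))

@[simp] theorem block_apply (e : κ ↪ ι) (θ : EuclideanSpace ℝ ι) (j : κ) :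
    block e θ j = θ (e j) := rfl

theorem norm_block_le (e : κ ↪ ι) : ‖block e‖ ≤ 1 :=
  LinearMap.mkContinuous_norm_le _ zero_le_one _

theorem norm_block_apply_le (e : κ ↪ ι) (θ : EuclideanSpace ℝ ι) : ‖block e θ‖ ≤ ‖θ‖ := by
  simpa using ContinuousLinearMap.le_of_opNorm_le _ (norm_block_le e) θ

theorem norm_toLp_sum_mul_le (A : EuclideanSpace ℝ (κ × κ')) (v : EuclideanSpace ℝ κ') :
    ‖(WithLp.toLp 2 fun i => ∑ j, A (i, j) * v j : EuclideanSpace ℝ κ)‖ ≤ ‖A‖ * ‖v‖ := by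
  refine le_of_sq_le_sq ?_ (by positivity)
  rw [mul_pow, EuclideanSpace.real_norm_sq_eq, EuclideanSpace.real_norm_sq_eq,
    EuclideanSpace.real_norm_sq_eq, Fintype.sum_prod_type, Finset.sum_mul]
  exact Finset.sum_le_sum fun i _ => Finset.sum_mul_sq_le_sq_mul_sq _ _ _

/-- A vector indexed by pairs, acting as a matrix. Its Euclidean norm is the Frobenius norm of the
matrix, so the norm of this action is at most `1`. -/
noncomputable def matAct :
    EuclideanSpace ℝ (κ × κ') →L[ℝ] EuclideanSpace ℝ κ' →L[ℝ] EuclideanSpace ℝ κ :=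
  LinearMap.mkContinuous₂
    (LinearMap.mk₂ ℝ (fun A v => WithLp.toLp 2 fun i => ∑ j, A (i, j) * v j)
      (fun _ _ _ => by ext; simp [add_mul, Finset.sum_add_distrib])
      (fun _ _ _ => by ext; simp [mul_assoc, Finset.mul_sum])
      (fun _ _ _ => by ext; simp [mul_add, Finset.sum_add_distrib])
      (fun _ _ _ => by ext; simp [mul_left_comm, Finset.mul_sum])) 1
    (fun A v => by
      rw [one_mul]
      exact norm_toLp_sum_mul_le A v)

theorem matAct_eq (A : EuclideanSpace ℝ (κ × κ')) (v : EuclideanSpace ℝ κ') :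
    matAct A v = WithLp.toLp 2 fun i => ∑ j, A (i, j) * v j := rfl

@[simp] theorem matAct_apply (A : EuclideanSpace ℝ (κ × κ')) (v : EuclideanSpace ℝ κ') (i : κ) :
    matAct A v i = ∑ j, A (i, j) * v j := rfl

theorem norm_matAct_apply_le (A : EuclideanSpace ℝ (κ × κ')) :
    ‖(matAct A : EuclideanSpace ℝ κ' →L[ℝ] EuclideanSpace ℝ κ)‖ ≤ ‖A‖ :=
  ContinuousLinearMap.opNorm_le_bound _ (norm_nonneg _) fun v =>
    (congrArg norm (matAct_eq A v)).trans_le (norm_toLp_sum_mul_le A v)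

-- Keeps unification from unfolding these maps down to coordinates.
attribute [irreducible] matAct block

end Coordinates

theorem norm_smul_block_le {ι κ : Type*} [Fintype ι] [Fintype κ] (τ : ℝ) (e : κ ↪ ι) :
    ‖τ • block e‖ ≤ |τ| := by
  rw [norm_smul]
  exact mul_le_of_le_one_right (abs_nonneg _) (norm_block_le e)

theorem norm_smul_block_apply_le {ι κ : Type*} [Fintype ι] [Fintype κ] (τ : ℝ) (e : κ ↪ ι)
    {θ : EuclideanSpace ℝ ι} {D : ℝ} (h : ‖block e θ‖ ≤ D) : ‖(τ • block e) θ‖ ≤ |τ| * D := by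
  rw [smul_apply, norm_smul, Real.norm_eq_abs]
  gcongr

/-- The weight matrix whose entries are the coordinates of the parameter selected by `e`, times the
factor `c`. -/
noncomputable def weightMap {ι κ κ' : Type*} [Fintype ι] [Fintype κ] [Fintype κ'] (c : ℝ)
    (e : κ × κ' ↪ ι) :
    EuclideanSpace ℝ ι →L[ℝ] EuclideanSpace ℝ κ' →L[ℝ] EuclideanSpace ℝ κ :=
  c • matAct.comp (block e)

section WeightMap

variable {ι κ κ' : Type*} [Fintype ι] [Fintype κ] [Fintype κ']

theorem weightMap_apply (c : ℝ) (e : κ × κ' ↪ ι) (θ : EuclideanSpace ℝ ι) :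
    weightMap c e θ = c • matAct (block e θ) := rfl

theorem norm_weightMap_apply {c : ℝ} (hc : 0 ≤ c) (e : κ × κ' ↪ ι) (θ : EuclideanSpace ℝ ι) :
    ‖weightMap c e θ‖ = c * ‖matAct (block e θ)‖ := by
  rw [weightMap_apply, norm_smul, Real.norm_of_nonneg hc]

theorem norm_weightMap_le {c : ℝ} (hc : 0 ≤ c) (e : κ × κ' ↪ ι) : ‖weightMap c e‖ ≤ c := by
  refine ContinuousLinearMap.opNorm_le_bound _ hc fun θ => ?_
  rw [norm_weightMap_apply hc]
  gcongr
  exact (norm_matAct_apply_le _).trans (norm_block_apply_le _ _)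

/-- The linear functional whose coefficients are the coordinates of the parameter selected by `e`,
times the factor `c`. -/
noncomputable def weightFunctional (c : ℝ) (e : κ ↪ ι) :
    EuclideanSpace ℝ ι →L[ℝ] EuclideanSpace ℝ κ →L[ℝ] ℝ :=
  c • (innerSL ℝ).comp (block e)

theorem weightFunctional_apply (c : ℝ) (e : κ ↪ ι) (θ : EuclideanSpace ℝ ι) :
    weightFunctional c e θ = c • innerSL ℝ (block e θ) := rfl

theorem norm_weightFunctional_apply {c : ℝ} (hc : 0 ≤ c) (e : κ ↪ ι) (θ : EuclideanSpace ℝ ι) :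
    ‖weightFunctional c e θ‖ = c * ‖block e θ‖ := by
  rw [weightFunctional_apply, norm_smul, Real.norm_of_nonneg hc, innerSL_apply_norm]

theorem norm_weightFunctional_le {c : ℝ} (hc : 0 ≤ c) (e : κ ↪ ι) :
    ‖weightFunctional c e‖ ≤ c := by
  refine ContinuousLinearMap.opNorm_le_bound _ hc fun θ => ?_
  rw [norm_weightFunctional_apply hc]
  gcongr
  exact norm_block_apply_le _ _

theorem norm_smul_proj_le (τ : ℝ) (i : ι) :
    ‖τ • (EuclideanSpace.proj i : EuclideanSpace ℝ ι →L[ℝ] ℝ)‖ ≤ |τ| := by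
  rw [norm_smul]
  refine mul_le_of_le_one_right (abs_nonneg _)
    (ContinuousLinearMap.opNorm_le_bound _ zero_le_one fun θ => ?_)
  rw [one_mul]
  exact PiLp.norm_apply_le θ _

end WeightMap

/-! ### The derivatives of the network -/

section Network

variable {n₀ n k : ℕ}

/-- The weights of the first layer. -/
def inputWeight (n₀ n k : ℕ) : Fin n × Fin n₀ ↪ ParamIdx n₀ n k :=
  ⟨fun p => Sum.inl (p.1, some p.2), fun p q h => by simpa [Prod.ext_iff] using h⟩

/-- The biases of the first layer. -/
def inputBias (n₀ n k : ℕ) : Fin n ↪ ParamIdx n₀ n k :=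
  ⟨fun i => Sum.inl (i, none), fun p q h => by simpa using h⟩

/-- The weights of the layer that computes hidden layer `ℓ + 2` from hidden layer `ℓ + 1`. -/
def hiddenWeight (n₀ n : ℕ) {k : ℕ} (ℓ : Fin k) : Fin n × Fin n ↪ ParamIdx n₀ n k :=
  ⟨fun p => Sum.inr (Sum.inl (ℓ, p.1, some p.2)), fun p q h => by simpa [Prod.ext_iff] using h⟩

/-- The biases of the layer that computes hidden layer `ℓ + 2` from hidden layer `ℓ + 1`. -/
def hiddenBias (n₀ n : ℕ) {k : ℕ} (ℓ : Fin k) : Fin n ↪ ParamIdx n₀ n k :=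
  ⟨fun i => Sum.inr (Sum.inl (ℓ, i, none)), fun p q h => by simpa using h⟩

/-- The weights of the output layer. -/
def outputWeight (n₀ n k : ℕ) : Fin n ↪ ParamIdx n₀ n k :=
  ⟨fun j => Sum.inr (Sum.inr (some j)), fun p q h => by simpa using h⟩

/-- The activations of a hidden layer as a Euclidean vector. -/
noncomputable def actVec (σ : ℝ → ℝ) (τ : ℝ) (x : EuclideanSpace ℝ (Fin n₀)) (ℓ : ℕ) (h : ℓ ≤ k)
    (θ : Params n₀ n k) : EuclideanSpace ℝ (Fin n) :=
  WithLp.toLp 2 (act σ τ θ x ℓ h)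

theorem actVec_zero (σ : ℝ → ℝ) (τ : ℝ) (x : EuclideanSpace ℝ (Fin n₀)) (h : 0 ≤ k) :
    actVec (n := n) σ τ x 0 h = fun θ => coordwise σ
      ((weightMap (√(n₀ : ℝ))⁻¹ (inputWeight n₀ n k)) θ x +
        (τ • block (inputBias n₀ n k)) θ) := by
  funext θ
  ext i
  simp [actVec, act, coordwise_apply, weightMap_apply, inputWeight, inputBias]
  rfl

theorem actVec_succ (σ : ℝ → ℝ) (τ : ℝ) (x : EuclideanSpace ℝ (Fin n₀)) (ℓ : ℕ) (h : ℓ + 1 ≤ k) :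
    actVec (n := n) σ τ x (ℓ + 1) h = fun θ => coordwise σ
      ((weightMap (√(n : ℝ))⁻¹ (hiddenWeight n₀ n ⟨ℓ, h⟩)) θ
          (actVec σ τ x ℓ (Nat.le_of_succ_le h) θ) +
        (τ • block (hiddenBias n₀ n ⟨ℓ, h⟩)) θ) := by
  funext θ
  ext i
  simp [actVec, act, coordwise_apply, weightMap_apply, hiddenWeight, hiddenBias]
  rfl

theorem net_eq (σ : ℝ → ℝ) (τ : ℝ) (x : EuclideanSpace ℝ (Fin n₀)) :
    net (n := n) (k := k) σ τ x = fun θ =>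
      weightFunctional (√(n : ℝ))⁻¹ (outputWeight n₀ n k) θ
          (actVec σ τ x k le_rfl θ) +
        (τ • EuclideanSpace.proj (𝕜 := ℝ) (Sum.inr (Sum.inr none))) θ := by
  funext θ
  simp [net, actVec, weightFunctional_apply, outputWeight, PiLp.inner_apply, mul_comm]
  exact Or.inl rfl

/-- The part of the parameter that enters the bounds on the derivatives has the size that is
typical for Gaussian parameters: the matrices of the hidden layers have operator norm at most
`C √n`, and the remaining blocks except the output bias have Euclidean norm at most `C √n`. -/
structure WellScaled (C : ℝ) (θ : Params n₀ n k) : Prop where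
  inputWeight_le : ‖block (inputWeight n₀ n k) θ‖ ≤ C * √n
  inputBias_le : ‖block (inputBias n₀ n k) θ‖ ≤ C * √n
  hiddenWeight_le : ∀ ℓ, ‖matAct (block (hiddenWeight n₀ n ℓ) θ)‖ ≤ C * √n
  hiddenBias_le : ∀ ℓ, ‖block (hiddenBias n₀ n ℓ) θ‖ ≤ C * √n
  outputWeight_le : ‖block (outputWeight n₀ n k) θ‖ ≤ C * √n

theorem wellScaled_norm (hn : 0 < n) (θ : Params n₀ n k) : WellScaled ‖θ‖ θ := by
  have h1 : (1 : ℝ) ≤ √n := Real.one_le_sqrt.2 (by exact_mod_cast hn)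
  have h2 : ‖θ‖ ≤ ‖θ‖ * √n := le_mul_of_one_le_right (norm_nonneg _) h1
  exact ⟨(norm_block_apply_le _ _).trans h2, (norm_block_apply_le _ _).trans h2,
    fun ℓ => (norm_matAct_apply_le _).trans ((norm_block_apply_le _ _).trans h2),
    fun ℓ => (norm_block_apply_le _ _).trans h2, (norm_block_apply_le _ _).trans h2⟩

variable {σ : ℝ → ℝ} {K : ℝ≥0} {B : ℝ}

theorem activation_layer_bounds {E H κ : Type*} [Fintype κ] [NormedAddCommGroup E]
    [NormedSpace ℝ E] [NormedAddCommGroup H] [NormedSpace ℝ H]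
    (hσ_lip : LipschitzWith K σ) (hσ : Differentiable ℝ σ)
    (hσ' : Differentiable ℝ (deriv σ)) (hB : ∀ z, |deriv (deriv σ) z| ≤ B)
    {F : E → H} {θ : E} {a₁ a₂ : ℝ} (hF : BoundedJet F θ a₁ a₂)
    (L : E →L[ℝ] H →L[ℝ] EuclideanSpace ℝ κ) (b : E →L[ℝ] EuclideanSpace ℝ κ)
    {c C R t D : ℝ} (hL : ‖L‖ ≤ c) (hLθ : ‖L θ‖ ≤ C)
    (hR : ‖F θ‖ ≤ R) (hb : ‖b‖ ≤ t) (hbθ : ‖b θ‖ ≤ D) :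
    ‖coordwise σ (L θ (F θ) + b θ)‖ ≤ |σ 0| * √(Fintype.card κ) + K * (C * R + D) ∧
      BoundedJet (fun θ => coordwise σ (L θ (F θ) + b θ)) θ (K * (c * R + C * a₁ + t))
        (B * (c * R + C * a₁ + t) ^ 2 + K * (2 * c * a₁ + C * a₂)) := by
  refine ⟨(norm_coordwise_le hσ_lip _).trans ?_,
    (hF.affine_layer L b hL hLθ hR hb).coordwise_comp hσ_lip hσ hσ' hB⟩
  have hC : 0 ≤ C := (norm_nonneg _).trans hLθ
  gcongr
  exact (norm_add_le _ _).trans (add_le_add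
    ((ContinuousLinearMap.le_of_opNorm_le _ hLθ _).trans (by gcongr)) hbθ)

/-- At well scaled parameters every hidden layer has activations of norm `O(√n)` and first and
second derivatives of norm `O(1)`, uniformly in the width. -/
theorem exists_bounds_actVec (hσ_lip : LipschitzWith K σ) (hσ : Differentiable ℝ σ)
    (hσ' : Differentiable ℝ (deriv σ)) (hB : ∀ z, |deriv (deriv σ) z| ≤ B) (τ C X : ℝ)
    (hn₀ : 0 < n₀) (ℓ : ℕ) (h : ℓ ≤ k) :
    ∃ r a₁ a₂ : ℝ, ∀ n, 0 < n → ∀ x : EuclideanSpace ℝ (Fin n₀), ‖x‖ ≤ X →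
      ∀ θ : Params n₀ n k, WellScaled C θ →
        ‖actVec σ τ x ℓ h θ‖ ≤ r * √n ∧ BoundedJet (actVec σ τ x ℓ h) θ a₁ a₂ := by
  induction ℓ with
  | zero =>
    refine ⟨|σ 0| + K * (C * X + |τ| * C), K * (X + |τ|), B * (X + |τ|) ^ 2, ?_⟩
    intro n hn x hx θ hθ
    have hs : (√(n₀ : ℝ))⁻¹ ≤ 1 :=
      inv_le_one_of_one_le₀ (Real.one_le_sqrt.2 (by exact_mod_cast hn₀))
    have hLθ : ‖(weightMap (√(n₀ : ℝ))⁻¹ (inputWeight n₀ n k)) θ‖ ≤ C * √n := by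
      rw [norm_weightMap_apply (by positivity)]
      exact (mul_le_of_le_one_left (norm_nonneg _) hs).trans
        ((norm_matAct_apply_le _).trans hθ.inputWeight_le)
    rw [actVec_zero]
    obtain ⟨h₁, h₂⟩ := activation_layer_bounds hσ_lip hσ hσ' hB (BoundedJet.const x θ) _ _
      ((norm_weightMap_le (by positivity) _).trans hs) hLθ hx
      (norm_smul_block_le τ (inputBias n₀ n k)) (norm_smul_block_apply_le τ _ hθ.inputBias_le)
    refine ⟨h₁.trans_eq ?_, h₂.mono (le_of_eq ?_) (le_of_eq ?_)⟩
    · rw [Fintype.card_fin]; ring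
    · ring
    · ring
  | succ ℓ ih =>
    obtain ⟨r, a₁, a₂, ih⟩ := ih (Nat.le_of_succ_le h)
    refine ⟨|σ 0| + K * (C * r + |τ| * C), K * (r + C * a₁ + |τ|),
      B * (r + C * a₁ + |τ|) ^ 2 + K * (2 * a₁ + C * a₂), ?_⟩
    intro n hn x hx θ hθ
    obtain ⟨hr, hF⟩ := ih n hn x hx θ hθ
    have hn' : (0 : ℝ) < √n := Real.sqrt_pos.2 (by exact_mod_cast hn)
    have hs : (√(n : ℝ))⁻¹ ≤ 1 :=
      inv_le_one_of_one_le₀ (Real.one_le_sqrt.2 (by exact_mod_cast hn))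
    have hLθ : ‖(weightMap (√(n : ℝ))⁻¹ (hiddenWeight n₀ n ⟨ℓ, h⟩)) θ‖ ≤ C := by
      rw [norm_weightMap_apply (by positivity), inv_mul_le_iff₀ hn', mul_comm]
      exact hθ.hiddenWeight_le _
    rw [actVec_succ]
    obtain ⟨h₁, h₂⟩ := activation_layer_bounds hσ_lip hσ hσ' hB hF _ _
      (norm_weightMap_le (by positivity) _) hLθ hr
      (norm_smul_block_le τ (hiddenBias n₀ n ⟨ℓ, h⟩))
      (norm_smul_block_apply_le τ _ (hθ.hiddenBias_le _))
    have e : (√(n : ℝ))⁻¹ * (r * √n) = r := by field_simp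
    rw [e] at h₂
    refine ⟨h₁.trans_eq ?_, h₂.mono le_rfl ?_⟩
    · rw [Fintype.card_fin]; ring
    · have := hF.nonneg₁
      gcongr
      exact mul_le_of_le_one_right zero_le_two hs

theorem exists_bounds_net (hσ_lip : LipschitzWith K σ) (hσ : Differentiable ℝ σ)
    (hσ' : Differentiable ℝ (deriv σ)) (hB : ∀ z, |deriv (deriv σ) z| ≤ B) (τ C X : ℝ)
    (hn₀ : 0 < n₀) (k : ℕ) :
    ∃ a₁ a₂ : ℝ, ∀ n, 0 < n → ∀ x : EuclideanSpace ℝ (Fin n₀), ‖x‖ ≤ X →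
      ∀ θ : Params n₀ n k, WellScaled C θ → BoundedJet (net σ τ x) θ a₁ a₂ := by
  obtain ⟨r, a₁, a₂, h⟩ :=
    exists_bounds_actVec (k := k) hσ_lip hσ hσ' hB τ C X hn₀ k le_rfl
  refine ⟨r + C * a₁ + |τ|, 2 * a₁ + C * a₂, fun n hn x hx θ hθ => ?_⟩
  obtain ⟨hr, hF⟩ := h n hn x hx θ hθ
  have hn' : (0 : ℝ) < √n := Real.sqrt_pos.2 (by exact_mod_cast hn)
  have hs : (√(n : ℝ))⁻¹ ≤ 1 :=
    inv_le_one_of_one_le₀ (Real.one_le_sqrt.2 (by exact_mod_cast hn))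
  rw [net_eq]
  have hLθ : ‖weightFunctional (√(n : ℝ))⁻¹ (outputWeight n₀ n k) θ‖ ≤ C := by
    rw [norm_weightFunctional_apply (by positivity), inv_mul_le_iff₀ hn', mul_comm]
    exact hθ.outputWeight_le
  have h := hF.affine_layer _ _ (norm_weightFunctional_le (by positivity) _) hLθ hr
    (norm_smul_proj_le τ (Sum.inr (Sum.inr none)))
  have e : (√(n : ℝ))⁻¹ * (r * √n) = r := by field_simp
  rw [e] at h
  refine h.mono le_rfl ?_
  have := hF.nonneg₁
  gcongr
  exact mul_le_of_le_one_right zero_le_two hs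

end Network

section Gradient

variable {E : Type*} [NormedAddCommGroup E] [InnerProductSpace ℝ E] [CompleteSpace E]
  {f : E → ℝ} {θ : E} {a₁ a₂ : ℝ}

theorem BoundedJet.differentiable_gradient (h : BoundedJet f θ a₁ a₂) :
    Differentiable ℝ (∇ f) :=
  (InnerProductSpace.toDual ℝ E).symm.toContinuousLinearEquiv.differentiable.comp h.diff_fderiv

theorem BoundedJet.norm_gradient_le (h : BoundedJet f θ a₁ a₂) : ‖∇ f θ‖ ≤ a₁ := by
  rw [gradient, LinearIsometryEquiv.norm_map]
  exact h.norm_fderiv_le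

theorem BoundedJet.norm_fderiv_gradient_le (h : BoundedJet f θ a₁ a₂) :
    ‖fderiv ℝ (∇ f) θ‖ ≤ a₂ := by
  refine ContinuousLinearMap.opNorm_le_bound _ h.nonneg₂ fun u => ?_
  have e : fderiv ℝ (∇ f) θ u = (InnerProductSpace.toDual ℝ E).symm
      (fderiv ℝ (fderiv ℝ f) θ u) := by
    have := ((InnerProductSpace.toDual ℝ E).symm.toContinuousLinearEquiv.hasFDerivAt.comp θ
      (h.diff_fderiv θ).hasFDerivAt).fderiv
    exact congrArg (fun T => T u) this
  rw [e, LinearIsometryEquiv.norm_map]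
  exact ContinuousLinearMap.le_of_opNorm_le _ h.norm_fderiv_fderiv_le u

end Gradient

/-! ### Tail bounds for standard Gaussian vectors and matrices -/

section Gaussian

variable {ι κ κ' : Type*} [Fintype ι] [Fintype κ] [Fintype κ']

theorem lintegral_exp_mul_sq_gaussianReal {s : ℝ} (hs : s < 1 / 2) :
    ∫⁻ z, ENNReal.ofReal (Real.exp (s * z ^ 2)) ∂(gaussianReal 0 1) =
      ENNReal.ofReal (√(1 - 2 * s))⁻¹ := by
  have ha : 0 < 1 - 2 * s := by linarith
  -- Tilting by `exp (s z²)` turns the density into a multiple of the one with variance `v`.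
  set v : ℝ≥0 := Real.toNNReal (1 - 2 * s)⁻¹ with hv
  have hv0 : v ≠ 0 := (Real.toNNReal_pos.2 (inv_pos.2 ha)).ne'
  have hvr : (v : ℝ) = (1 - 2 * s)⁻¹ := Real.coe_toNNReal _ (inv_pos.2 ha).le
  have key : ∀ z, gaussianPDF 0 1 z * ENNReal.ofReal (Real.exp (s * z ^ 2)) =
      ENNReal.ofReal (√(1 - 2 * s))⁻¹ * ENNReal.ofReal (gaussianPDFReal 0 v z) := by
    intro z
    rw [gaussianPDF, ← ENNReal.ofReal_mul (gaussianPDFReal_nonneg _ _ _),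
      ← ENNReal.ofReal_mul (by positivity)]
    congr 1
    have e1 : √(2 * Real.pi * (v : ℝ)) = √(2 * Real.pi) * (√(1 - 2 * s))⁻¹ := by
      rw [hvr, Real.sqrt_mul (by positivity), Real.sqrt_inv]
    have e2 : -(z - 0) ^ 2 / (2 * (v : ℝ)) = -z ^ 2 / 2 + s * z ^ 2 := by
      rw [hvr]; field_simp; ring
    have h3 : √(1 - 2 * s) ≠ 0 := (Real.sqrt_pos.2 ha).ne'
    simp only [gaussianPDFReal]
    rw [e1, e2, Real.exp_add]
    simp only [NNReal.coe_one, mul_one, sub_zero]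
    field_simp
  rw [gaussianReal_of_var_ne_zero _ one_ne_zero,
    lintegral_withDensity_eq_lintegral_mul _ (measurable_gaussianPDF _ _) (by fun_prop)]
  simp only [Pi.mul_apply, key]
  rw [lintegral_const_mul _ (by fun_prop), lintegral_gaussianPDFReal_eq_one _ hv0, mul_one]

theorem lintegral_exp_mul_norm_sq_stdGaussian {s : ℝ} (hs : s < 1 / 2) :
    ∫⁻ θ, ENNReal.ofReal (Real.exp (s * ‖θ‖ ^ 2)) ∂(stdGaussian (EuclideanSpace ℝ ι)) =
      ENNReal.ofReal (√(1 - 2 * s))⁻¹ ^ Fintype.card ι := by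
  rw [← map_pi_eq_stdGaussian, lintegral_map (by fun_prop) (by fun_prop)]
  have h1 : ∀ z : ι → ℝ, ENNReal.ofReal (Real.exp (s * ‖WithLp.toLp 2 z‖ ^ 2)) =
      ∏ i, ENNReal.ofReal (Real.exp (s * z i ^ 2)) := by
    intro z
    rw [EuclideanSpace.real_norm_sq_eq, Finset.mul_sum, Real.exp_sum,
      ENNReal.ofReal_prod_of_nonneg fun _ _ => (Real.exp_pos _).le]
  simp_rw [h1]
  have hm : Measurable fun x : ℝ => ENNReal.ofReal (Real.exp (s * x ^ 2)) := by fun_prop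
  rw [lintegral_prod_eq_prod_lintegral_of_indepFun Finset.univ
    (fun i (z : ι → ℝ) => ENNReal.ofReal (Real.exp (s * z i ^ 2)))
    (iIndepFun_pi (μ := fun _ : ι => gaussianReal 0 1) fun i => hm.aemeasurable)
    (fun i => hm.comp (measurable_pi_apply i))]
  have h2 : ∀ i : ι, ∫⁻ z : ι → ℝ, ENNReal.ofReal (Real.exp (s * z i ^ 2))
      ∂(Measure.pi fun _ => gaussianReal 0 1) = ENNReal.ofReal (√(1 - 2 * s))⁻¹ := by
    intro i
    rw [← lintegral_exp_mul_sq_gaussianReal hs,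
      ← (measurePreserving_eval (fun _ : ι => gaussianReal 0 1) i).lintegral_comp hm]
  simp_rw [h2, Finset.prod_const, Finset.card_univ]

theorem measure_lt_norm_le {Ω : Type*} [MeasurableSpace Ω] (μ : Measure Ω) {X : Ω → ℝ}
    (hX : Measurable X) {s M : ℝ} (hs : 0 ≤ s)
    (h : ∫⁻ ω, ENNReal.ofReal (Real.exp (s * X ω ^ 2)) ∂μ ≤ ENNReal.ofReal M) {r : ℝ}
    (hr : 0 ≤ r) : μ {ω | r < X ω} ≤ ENNReal.ofReal (Real.exp (-(s * r ^ 2)) * M) := by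
  have h1 := mul_meas_ge_le_lintegral (μ := μ)
    (f := fun ω => ENNReal.ofReal (Real.exp (s * X ω ^ 2))) (by fun_prop)
    (ENNReal.ofReal (Real.exp (s * r ^ 2)))
  have h2 : μ {ω | r < X ω} ≤ μ {ω | ENNReal.ofReal (Real.exp (s * r ^ 2)) ≤
      ENNReal.ofReal (Real.exp (s * X ω ^ 2))} := by
    refine measure_mono fun ω hω => ENNReal.ofReal_le_ofReal (Real.exp_le_exp.2 ?_)
    have : r ≤ X ω := le_of_lt hω
    gcongr
  rw [ENNReal.ofReal_mul (Real.exp_pos _).le, Real.exp_neg,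
    ENNReal.ofReal_inv_of_pos (Real.exp_pos _), mul_comm, ← div_eq_mul_inv,
    ENNReal.le_div_iff_mul_le (by simp [Real.exp_pos]) (by simp), mul_comm]
  calc ENNReal.ofReal (Real.exp (s * r ^ 2)) * μ {ω | r < X ω} ≤ _ := by gcongr
    _ ≤ _ := h1
    _ ≤ _ := h

theorem measure_lt_norm_stdGaussian_le {s : ℝ} (hs : 0 ≤ s) (hs' : s < 1 / 2) {r : ℝ}
    (hr : 0 ≤ r) : stdGaussian (EuclideanSpace ℝ ι) {θ | r < ‖θ‖} ≤
      ENNReal.ofReal (Real.exp (-(s * r ^ 2)) * (√(1 - 2 * s))⁻¹ ^ Fintype.card ι) :=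
  measure_lt_norm_le _ measurable_norm hs
    (by rw [lintegral_exp_mul_norm_sq_stdGaussian hs', ENNReal.ofReal_pow (by positivity)]) hr

/-- The bound `-log (1 - 2 s) / 2 ≤ s + s² / (1 - 2 s)`. With `exp y = 1 / (1 - 2 s)` it says
`y ≤ sinh y`. -/
theorem inv_sqrt_one_sub_le_exp {s : ℝ} (hs : 0 ≤ s) (hs' : s < 1 / 2) :
    (√(1 - 2 * s))⁻¹ ≤ Real.exp (s + s ^ 2 / (1 - 2 * s)) := by
  have hu : 0 < 1 - 2 * s := by linarith
  set y := -Real.log (1 - 2 * s) with hy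
  have hy0 : 0 ≤ y := neg_nonneg.2 (Real.log_nonpos hu.le (by linarith))
  have hsinh := Real.self_le_sinh_iff.2 hy0
  rw [Real.sinh_eq, hy, neg_neg, Real.exp_neg, Real.exp_log hu, ← hy] at hsinh
  have h1 : (√(1 - 2 * s))⁻¹ = Real.exp (y / 2) := by
    rw [Real.sqrt_eq_rpow, Real.rpow_def_of_pos hu, ← Real.exp_neg, hy]
    congr 1; ring
  rw [h1, Real.exp_le_exp]
  have h2 : s + s ^ 2 / (1 - 2 * s) = ((1 - 2 * s)⁻¹ - (1 - 2 * s)) / 4 := by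
    have hi : (1 - 2 * s) * (1 - 2 * s)⁻¹ = 1 := mul_inv_cancel₀ hu.ne'
    rw [div_eq_mul_inv]
    linear_combination (1 / 4) * ((1 - 2 * s) - 2) * hi
  rw [h2]
  linarith

/-- The Laurent–Massart tail bound for the `χ²` distribution. -/
theorem measure_radius_lt_norm_le {δ : ℝ} (hδ0 : 0 < δ) (hδ1 : δ < 1) :
    stdGaussian (EuclideanSpace ℝ ι) {θ | radius (Fintype.card ι) δ < ‖θ‖} ≤
      ENNReal.ofReal δ := by
  rcases isEmpty_or_nonempty ι with hι | hι
  · have : {θ : EuclideanSpace ℝ ι | radius (Fintype.card ι) δ < ‖θ‖} = ∅ := by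
      refine Set.eq_empty_of_forall_notMem fun θ hθ => ?_
      have h0 : ‖θ‖ = 0 := by rw [Subsingleton.elim θ 0, norm_zero]
      have h1 : 0 ≤ radius (Fintype.card ι) δ := Real.sqrt_nonneg _
      exact absurd hθ (by rw [Set.mem_ofPred_eq, h0]; exact h1.not_gt)
    rw [this, measure_empty]
    exact zero_le
  set d := Fintype.card ι with hd
  set t := Real.log (1 / δ) with ht
  have ht0 : 0 < t := Real.log_pos (by rw [lt_div_iff₀ hδ0]; linarith)
  have hd0 : (0 : ℝ) < d := by exact_mod_cast Fintype.card_pos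
  set a := √(d : ℝ) with ha
  set b := √t with hb
  have ha0 : 0 < a := Real.sqrt_pos.2 hd0
  have hb0 : 0 < b := Real.sqrt_pos.2 ht0
  have ha2 : a ^ 2 = d := Real.sq_sqrt hd0.le
  have hb2 : b ^ 2 = t := Real.sq_sqrt ht0.le
  have hR : radius d δ ^ 2 = a ^ 2 + 2 * (a * b) + 2 * b ^ 2 := by
    rw [radius, Real.sq_sqrt (by positivity), Real.sqrt_mul hd0.le, ha2, hb2]
  -- The exponent that optimizes the Chernoff bound.
  set s := b / (a + 2 * b) with hs
  have hs0 : 0 ≤ s := by positivity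
  have hs1 : s < 1 / 2 := by rw [hs, div_lt_div_iff₀ (by positivity) two_pos]; linarith
  have hu : 1 - 2 * s = a / (a + 2 * b) := by rw [hs]; field_simp; ring
  refine (measure_lt_norm_stdGaussian_le hs0 hs1 (Real.sqrt_nonneg _)).trans
    (ENNReal.ofReal_le_ofReal ?_)
  calc Real.exp (-(s * radius d δ ^ 2)) * (√(1 - 2 * s))⁻¹ ^ d
      ≤ Real.exp (-(s * radius d δ ^ 2)) * Real.exp (s + s ^ 2 / (1 - 2 * s)) ^ d := by
        gcongr
        exact inv_sqrt_one_sub_le_exp hs0 hs1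
    _ = Real.exp (-t) := by
        rw [← Real.exp_nat_mul, ← Real.exp_add, hR, hu, ← ha2, ← hb2, hs]
        congr 1
        field_simp
        ring
    _ = δ := by rw [ht, one_div, Real.log_inv, neg_neg, Real.exp_log hδ0]

/-- A linear map whose adjoint multiplies norms by `c` maps the standard Gaussian law to the law of
`c` times a standard Gaussian vector. -/
theorem map_stdGaussian_eq {L : EuclideanSpace ℝ ι →L[ℝ] EuclideanSpace ℝ κ} {c : ℝ}
    (hL : ∀ t, ∃ v, ‖v‖ = c * ‖t‖ ∧ ∀ A, inner ℝ (L A) t = inner ℝ A v) :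
    (stdGaussian (EuclideanSpace ℝ ι)).map L =
      (stdGaussian (EuclideanSpace ℝ κ)).map (fun g => c • g) := by
  refine Measure.ext_of_charFun (funext fun t => ?_)
  obtain ⟨v, hv, hLv⟩ := hL t
  rw [charFun_map_smul, charFun_stdGaussian, norm_smul, charFun_apply,
    integral_map (by fun_prop) (by fun_prop)]
  simp_rw [hLv]
  rw [← charFun_apply, charFun_stdGaussian, hv, ← Complex.ofReal_pow, ← Complex.ofReal_pow, mul_pow,
    mul_pow, Real.norm_eq_abs, sq_abs]

theorem map_block_stdGaussian (e : κ ↪ ι) :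
    (stdGaussian (EuclideanSpace ℝ ι)).map (block e) = stdGaussian (EuclideanSpace ℝ κ) := by
  classical
  rw [map_stdGaussian_eq (c := 1)]
  · simp
  intro t
  have he := (EuclideanSpace.basisFun ι ℝ).orthonormal.comp e e.injective
  refine ⟨∑ j, t j • EuclideanSpace.basisFun ι ℝ (e j), ?_, fun A => ?_⟩
  · have h := he.inner_sum (fun j => t j) (fun j => t j) Finset.univ
    simp only [Function.comp_apply, real_inner_self_eq_norm_sq, conj_trivial] at h
    rw [one_mul, ← sq_eq_sq₀ (norm_nonneg _) (norm_nonneg _), h, EuclideanSpace.real_norm_sq_eq]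
    simp only [sq]
  · simp [inner_sum, inner_smul_right, PiLp.inner_apply]

theorem lintegral_exp_mul_norm_sq_matAct_le {s : ℝ} (hs : 0 ≤ s) (hs' : s < 1 / 2)
    {u : EuclideanSpace ℝ κ'} (hu : ‖u‖ ≤ 1) :
    ∫⁻ A, ENNReal.ofReal (Real.exp (s * ‖(matAct A u : EuclideanSpace ℝ κ)‖ ^ 2))
      ∂(stdGaussian (EuclideanSpace ℝ (κ × κ'))) ≤
        ENNReal.ofReal ((√(1 - 2 * s))⁻¹ ^ Fintype.card κ) := by
  have hmap := map_stdGaussian_eq (L := (matAct (κ := κ) (κ' := κ')).flip u) (c := ‖u‖) fun t => by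
    refine ⟨WithLp.toLp 2 fun p : κ × κ' => t p.1 * u p.2, ?_, fun A => ?_⟩
    · rw [← sq_eq_sq₀ (norm_nonneg _) (by positivity), mul_pow, EuclideanSpace.real_norm_sq_eq,
        EuclideanSpace.real_norm_sq_eq, EuclideanSpace.real_norm_sq_eq, Fintype.sum_prod_type,
        mul_comm, Finset.sum_mul_sum]
      simp only [mul_pow]
    · simp only [PiLp.inner_apply, ContinuousLinearMap.flip_apply, matAct_apply,
        Fintype.sum_prod_type]
      refine Finset.sum_congr rfl fun i _ => ?_
      simp only [RCLike.inner_apply, conj_trivial, Finset.mul_sum]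
      exact Finset.sum_congr rfl fun j _ => by ring
  have hm : Measurable fun g : EuclideanSpace ℝ κ =>
      ENNReal.ofReal (Real.exp (s * ‖g‖ ^ 2)) := by fun_prop
  calc ∫⁻ A, ENNReal.ofReal (Real.exp (s * ‖(matAct A u : EuclideanSpace ℝ κ)‖ ^ 2))
        ∂(stdGaussian (EuclideanSpace ℝ (κ × κ')))
      = ∫⁻ g, ENNReal.ofReal (Real.exp (s * ‖g‖ ^ 2))
          ∂((stdGaussian (EuclideanSpace ℝ (κ × κ'))).map ((matAct (κ := κ) (κ' := κ')).flip u)) :=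
        (lintegral_map hm (by fun_prop)).symm
    _ = ∫⁻ g, ENNReal.ofReal (Real.exp (s * ‖‖u‖ • g‖ ^ 2))
          ∂(stdGaussian (EuclideanSpace ℝ κ)) := by
        rw [hmap, lintegral_map hm (by fun_prop)]
    _ ≤ ∫⁻ g, ENNReal.ofReal (Real.exp (s * ‖g‖ ^ 2)) ∂(stdGaussian (EuclideanSpace ℝ κ)) := by
        gcongr with g
        rw [norm_smul, norm_norm]
        exact mul_le_of_le_one_left (norm_nonneg _) hu
    _ = _ := by
        rw [lintegral_exp_mul_norm_sq_stdGaussian hs', ENNReal.ofReal_pow (by positivity)]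

/-- If `M` has operator norm more than `T`, then `‖M u‖ ≥ T / 4` on a ball of radius `1 / 4` inside
the unit ball, centred at `3 / 4` times a vector that almost attains the norm. -/
theorem le_setLIntegral_exp_norm_sq {G : Type*} [NormedAddCommGroup G] [NormedSpace ℝ G]
    (M : EuclideanSpace ℝ κ →L[ℝ] G) {T : ℝ} (hT : 0 ≤ T) (hM : T < ‖M‖) :
    volume (Metric.ball (0 : EuclideanSpace ℝ κ) 1) *
        ENNReal.ofReal (Real.exp (3 / 128 * T ^ 2) * (1 / 4) ^ Fintype.card κ) ≤
      ∫⁻ u in Metric.ball 0 1, ENNReal.ofReal (Real.exp (3 / 8 * ‖M u‖ ^ 2)) := by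
  have hM0 : 0 < ‖M‖ := hT.trans_lt hM
  obtain ⟨v, hv1, hv⟩ := M.exists_lt_apply_of_lt_opNorm
    (show 2 / 3 * ‖M‖ < ‖M‖ by linarith)
  have hsub : Metric.ball ((3 / 4 : ℝ) • v) (1 / 4) ⊆ Metric.ball 0 1 := by
    refine Metric.ball_subset_ball' ?_
    rw [dist_zero_right, norm_smul, Real.norm_of_nonneg (by norm_num)]
    linarith
  have hbig : ∀ u ∈ Metric.ball ((3 / 4 : ℝ) • v) (1 / 4), T / 4 ≤ ‖M u‖ := by
    intro u hu
    have h1 : ‖M ((3 / 4 : ℝ) • v)‖ = 3 / 4 * ‖M v‖ := by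
      rw [map_smul, norm_smul, Real.norm_of_nonneg (by norm_num)]
    have h2 : ‖M ((3 / 4 : ℝ) • v) - M u‖ ≤ ‖M‖ * (1 / 4) := by
      rw [← map_sub]
      refine M.le_opNorm_of_le ?_
      rw [norm_sub_rev]
      exact (mem_ball_iff_norm.1 hu).le
    have h3 := norm_sub_norm_le (M ((3 / 4 : ℝ) • v)) (M u)
    linarith
  calc volume (Metric.ball (0 : EuclideanSpace ℝ κ) 1) *
        ENNReal.ofReal (Real.exp (3 / 128 * T ^ 2) * (1 / 4) ^ Fintype.card κ)
      = ENNReal.ofReal (Real.exp (3 / 128 * T ^ 2)) *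
          volume (Metric.ball ((3 / 4 : ℝ) • v) (1 / 4)) := by
        rw [Measure.addHaar_ball_of_pos _ ((3 / 4 : ℝ) • v) (by norm_num : (0 : ℝ) < 1 / 4),
          ENNReal.ofReal_mul (Real.exp_pos _).le, finrank_euclideanSpace]
        ring
    _ = ∫⁻ _ in Metric.ball ((3 / 4 : ℝ) • v) (1 / 4),
          ENNReal.ofReal (Real.exp (3 / 128 * T ^ 2)) := (setLIntegral_const _ _).symm
    _ ≤ ∫⁻ u in Metric.ball ((3 / 4 : ℝ) • v) (1 / 4),
          ENNReal.ofReal (Real.exp (3 / 8 * ‖M u‖ ^ 2)) := by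
        refine setLIntegral_mono ?_ fun u hu => ?_
        · exact ENNReal.measurable_ofReal.comp (Real.continuous_exp.comp
            (continuous_const.mul (M.continuous.norm.pow 2))).measurable
        · refine ENNReal.ofReal_le_ofReal (Real.exp_le_exp.2 ?_)
          have h := pow_le_pow_left₀ (by positivity) (hbig u hu) 2
          linarith
    _ ≤ _ := lintegral_mono_set hsub

/-- The operator norm of a Gaussian matrix. For a fixed unit vector `u`, the expectation of
`exp (3 / 8 * ‖A u‖²)` is at most `2 ^ card κ`; the same therefore holds for its mean over `u`
uniform in the unit ball, which by `le_setLIntegral_exp_norm_sq` is large as soon as the operator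
norm is. This averaging replaces the usual union bound over a net of the sphere. -/
theorem measure_lt_norm_matAct_le {T : ℝ} (hT : 0 ≤ T) :
    stdGaussian (EuclideanSpace ℝ (κ × κ'))
      {A | T < ‖(matAct A : EuclideanSpace ℝ κ' →L[ℝ] EuclideanSpace ℝ κ)‖} ≤
        ENNReal.ofReal
          (4 ^ Fintype.card κ' * 2 ^ Fintype.card κ * Real.exp (-(3 / 128 * T ^ 2))) := by
  set V := volume (Metric.ball (0 : EuclideanSpace ℝ κ') 1) with hV
  have hV0 : V ≠ 0 := (Metric.measure_ball_pos _ _ one_pos).ne'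
  have hVtop : V ≠ ⊤ := measure_ball_lt_top.ne
  set P := stdGaussian (EuclideanSpace ℝ (κ × κ')) with hP
  set g : EuclideanSpace ℝ (κ × κ') → EuclideanSpace ℝ κ' → ENNReal := fun A u =>
    ENNReal.ofReal (Real.exp (3 / 8 * ‖(matAct A u : EuclideanSpace ℝ κ)‖ ^ 2)) with hg
  have hgm : Measurable (Function.uncurry g) := by
    refine ENNReal.measurable_ofReal.comp (Continuous.measurable ?_)
    have : Continuous fun p : EuclideanSpace ℝ (κ × κ') × EuclideanSpace ℝ κ' =>
        (matAct p.1 p.2 : EuclideanSpace ℝ κ) :=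
      (matAct.continuous.comp continuous_fst).clm_apply continuous_snd
    exact Real.continuous_exp.comp (continuous_const.mul (this.norm.pow 2))
  have hupper : ∫⁻ A, (∫⁻ u in Metric.ball 0 1, g A u) ∂P ≤
      V * ENNReal.ofReal (2 ^ Fintype.card κ) := by
    rw [lintegral_lintegral_swap hgm.aemeasurable]
    have h2 : (√(1 - 2 * (3 / 8 : ℝ)))⁻¹ = 2 := by
      rw [show (1 - 2 * (3 / 8 : ℝ)) = (1 / 2) ^ 2 by norm_num, Real.sqrt_sq (by norm_num)]
      norm_num
    calc ∫⁻ u in Metric.ball 0 1, (∫⁻ A, g A u ∂P)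
        ≤ ∫⁻ _ in Metric.ball (0 : EuclideanSpace ℝ κ') 1,
            ENNReal.ofReal (2 ^ Fintype.card κ) := by
          refine setLIntegral_mono measurable_const fun u hu => ?_
          have h := lintegral_exp_mul_norm_sq_matAct_le (κ := κ) (s := 3 / 8) (by norm_num)
            (by norm_num) (mem_ball_zero_iff.1 hu).le
          rwa [h2] at h
      _ = V * ENNReal.ofReal (2 ^ Fintype.card κ) := by
          rw [setLIntegral_const, mul_comm]
  set e : ℝ := Real.exp (3 / 128 * T ^ 2) * (1 / 4) ^ Fintype.card κ' with he
  have he0 : 0 < e := by positivity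
  have hmarkov := mul_meas_ge_le_lintegral (μ := P)
    (f := fun A => ∫⁻ u in Metric.ball 0 1, g A u) hgm.lintegral_prod_right'
    (V * ENNReal.ofReal e)
  have h1 : V * (ENNReal.ofReal e *
      P {A | T < ‖(matAct A : EuclideanSpace ℝ κ' →L[ℝ] EuclideanSpace ℝ κ)‖}) ≤
        V * ENNReal.ofReal (2 ^ Fintype.card κ) := by
    rw [← mul_assoc]
    exact (mul_le_mul_right (measure_mono fun A hA => le_setLIntegral_exp_norm_sq _ hT hA)
      _).trans (hmarkov.trans hupper)
  have h2 := (ENNReal.mul_le_mul_iff_right hV0 hVtop).1 h1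
  have h3 : 4 ^ Fintype.card κ' * 2 ^ Fintype.card κ * Real.exp (-(3 / 128 * T ^ 2)) =
      2 ^ Fintype.card κ / e := by
    rw [he, Real.exp_neg, one_div, inv_pow]
    field_simp
  rw [h3, ENNReal.ofReal_div_of_pos he0, ENNReal.le_div_iff_mul_le (by simp [he0]) (by simp),
    mul_comm]
  exact h2

theorem measure_block_le {n : ℕ} {q C δ : ℝ} (hδ0 : 0 < δ) (hδ1 : δ < 1) (hC : 0 ≤ C)
    (hn : 0 < n) (hq : (Fintype.card κ : ℝ) ≤ q * n)
    (h : 2 * q + 3 * Real.log (1 / δ) ≤ C ^ 2) (e : κ ↪ ι) :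
    stdGaussian (EuclideanSpace ℝ ι) {θ | C * √n < ‖block e θ‖} ≤ ENNReal.ofReal δ := by
  have hn' : (1 : ℝ) ≤ n := by exact_mod_cast hn
  have hL : 0 ≤ Real.log (1 / δ) := Real.log_nonneg (by rw [le_div_iff₀ hδ0]; linarith)
  have hrad : radius (Fintype.card κ) δ ≤ C * √n := by
    refine Real.sqrt_le_iff.2 ⟨by positivity, ?_⟩
    rw [mul_pow, Real.sq_sqrt (by positivity)]
    have h1 : 2 * √(Fintype.card κ * Real.log (1 / δ)) ≤ Fintype.card κ + Real.log (1 / δ) := by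
      rw [Real.sqrt_mul (by positivity)]
      have h2 := two_mul_le_add_sq (√(Fintype.card κ : ℝ)) (√(Real.log (1 / δ)))
      rw [Real.sq_sqrt (by positivity), Real.sq_sqrt hL] at h2
      linarith
    have h3 : (2 * q + 3 * Real.log (1 / δ)) * n ≤ C ^ 2 * n := by gcongr
    nlinarith
  calc stdGaussian (EuclideanSpace ℝ ι) {θ | C * √n < ‖block e θ‖}
      ≤ stdGaussian (EuclideanSpace ℝ ι)
          (block e ⁻¹' {g | radius (Fintype.card κ) δ < ‖g‖}) :=
        measure_mono fun θ hθ => hrad.trans_lt hθ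
    _ = stdGaussian (EuclideanSpace ℝ κ) {g | radius (Fintype.card κ) δ < ‖g‖} := by
        rw [← map_block_stdGaussian e, Measure.map_apply (by fun_prop)]
        exact measurableSet_lt measurable_const measurable_norm
    _ ≤ ENNReal.ofReal δ := measure_radius_lt_norm_le hδ0 hδ1

theorem measure_matAct_block_le {n : ℕ} {C δ : ℝ} (hδ0 : 0 < δ) (hδ1 : δ < 1) (hC : 0 ≤ C)
    (hn : 0 < n) (h : 128 / 3 * (3 + Real.log (1 / δ)) ≤ C ^ 2) (e : Fin n × Fin n ↪ ι) :
    stdGaussian (EuclideanSpace ℝ ι) {θ | C * √n < ‖matAct (block e θ)‖} ≤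
      ENNReal.ofReal δ := by
  have hm : MeasurableSet {A : EuclideanSpace ℝ (Fin n × Fin n) | C * √n < ‖matAct A‖} :=
    measurableSet_lt measurable_const matAct.continuous.norm.measurable
  calc stdGaussian (EuclideanSpace ℝ ι) {θ | C * √n < ‖matAct (block e θ)‖}
      = (stdGaussian (EuclideanSpace ℝ ι)).map (block e) {A | C * √n < ‖matAct A‖} :=
        (Measure.map_apply (by fun_prop) hm).symm
    _ ≤ ENNReal.ofReal (4 ^ n * 2 ^ n * Real.exp (-(3 / 128 * (C * √n) ^ 2))) := by
        rw [map_block_stdGaussian]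
        simpa using measure_lt_norm_matAct_le (κ := Fin n) (κ' := Fin n)
          (T := C * √n) (by positivity)
    _ ≤ ENNReal.ofReal δ := by
        refine ENNReal.ofReal_le_ofReal ?_
        rw [mul_pow C, Real.sq_sqrt (by positivity), ← mul_pow]
        have h8 : (8 : ℝ) ≤ Real.exp 3 := by
          have h2 : (2 : ℝ) ≤ Real.exp 1 := by linarith [Real.exp_one_gt_d9]
          calc (8 : ℝ) = 2 ^ 3 := by norm_num
            _ ≤ Real.exp 1 ^ 3 := by gcongr
            _ = Real.exp 3 := by rw [← Real.exp_nat_mul]; norm_num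
        calc (4 * 2 : ℝ) ^ n * Real.exp (-(3 / 128 * (C ^ 2 * n)))
            ≤ Real.exp 3 ^ n * Real.exp (-((3 + Real.log (1 / δ)) * n)) := by
              refine mul_le_mul (pow_le_pow_left₀ (by norm_num) (by linarith) n)
                (Real.exp_le_exp.2 ?_) (Real.exp_pos _).le (by positivity)
              have : (128 / 3 * (3 + Real.log (1 / δ))) * n ≤ C ^ 2 * n := by gcongr
              linarith
          _ = Real.exp (Real.log δ) ^ n := by
              rw [← Real.exp_nat_mul, ← Real.exp_nat_mul, ← Real.exp_add, one_div, Real.log_inv]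
              congr 1
              ring
          _ = δ ^ n := by rw [Real.exp_log hδ0]
          _ ≤ δ := pow_le_of_le_one hδ0.le hδ1.le hn.ne'

end Gaussian

/-! ### Gaussian parameters are well scaled -/

/-- With high probability the Gaussian parameters are well scaled, with a constant that does not
depend on the width. -/
theorem exists_wellScaled (n₀ k : ℕ) {δ : ℝ} (hδ0 : 0 < δ) (hδ1 : δ < 1) :
    ∃ C : ℝ, ∀ n, 0 < n →
      stdGaussian (Params n₀ n k) {θ | ¬ WellScaled C θ} ≤ ENNReal.ofReal δ := by
  -- The number of blocks that have to be controlled is `2 k + 3`.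
  set ε : ℝ := δ / (2 * k + 3) with hε
  have hε0 : 0 < ε := by positivity
  have hε1 : ε < 1 := by
    rw [hε, div_lt_one (by positivity)]
    linarith [(Nat.cast_nonneg k : (0 : ℝ) ≤ k)]
  have hL : 0 ≤ Real.log (1 / ε) := Real.log_nonneg (by rw [le_div_iff₀ hε0]; linarith)
  set C : ℝ := √(128 / 3 * (3 + Real.log (1 / ε)) + 2 * (n₀ + 1)) with hCdef
  have hC0 : 0 ≤ C := Real.sqrt_nonneg _
  have hC2 : C ^ 2 = 128 / 3 * (3 + Real.log (1 / ε)) + 2 * (n₀ + 1) :=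
    Real.sq_sqrt (by positivity)
  have hn₀ : (0 : ℝ) ≤ n₀ := Nat.cast_nonneg _
  refine ⟨C, fun n hn => ?_⟩
  have hvec : ∀ e : Fin n ↪ ParamIdx n₀ n k,
      stdGaussian (Params n₀ n k) {θ | C * √n < ‖block e θ‖} ≤ ENNReal.ofReal ε :=
    measure_block_le (q := 1) hε0 hε1 hC0 hn (by simp) (by rw [hC2]; linarith)
  have hmat : ∀ ℓ : Fin k, stdGaussian (Params n₀ n k)
      {θ | C * √n < ‖matAct (block (hiddenWeight n₀ n ℓ) θ)‖} ≤ ENNReal.ofReal ε := fun ℓ =>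
    measure_matAct_block_le hε0 hε1 hC0 hn (by rw [hC2]; linarith) (hiddenWeight n₀ n ℓ)
  have hin : stdGaussian (Params n₀ n k) {θ | C * √n < ‖block (inputWeight n₀ n k) θ‖} ≤
      ENNReal.ofReal ε :=
    measure_block_le (q := n₀) hε0 hε1 hC0 hn (by simp [mul_comm]) (by rw [hC2]; linarith) _
  have hsub : {θ : Params n₀ n k | ¬ WellScaled C θ} ⊆
      {θ | C * √n < ‖block (inputWeight n₀ n k) θ‖} ∪
      {θ | C * √n < ‖block (inputBias n₀ n k) θ‖} ∪
      (⋃ ℓ : Fin k, {θ | C * √n < ‖matAct (block (hiddenWeight n₀ n ℓ) θ)‖}) ∪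
      (⋃ ℓ : Fin k, {θ | C * √n < ‖block (hiddenBias n₀ n ℓ) θ‖}) ∪
      {θ | C * √n < ‖block (outputWeight n₀ n k) θ‖} := by
    intro θ hθ
    by_contra hcon
    simp only [Set.mem_union, Set.mem_iUnion, Set.mem_ofPred_eq, not_or, not_exists,
      not_lt] at hcon
    obtain ⟨⟨⟨⟨h₁, h₂⟩, h₃⟩, h₄⟩, h₅⟩ := hcon
    exact hθ ⟨h₁, h₂, h₃, h₄, h₅⟩
  have hunion : ∀ s : Fin k → Set (Params n₀ n k),
      (∀ ℓ, stdGaussian (Params n₀ n k) (s ℓ) ≤ ENNReal.ofReal ε) →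
        stdGaussian (Params n₀ n k) (⋃ ℓ, s ℓ) ≤ ENNReal.ofReal (k * ε) := by
    intro s hs
    refine (measure_iUnion_fintype_le _ _).trans ((Finset.sum_le_sum fun ℓ _ => hs ℓ).trans ?_)
    rw [Finset.sum_const, Finset.card_univ, Fintype.card_fin, nsmul_eq_mul,
      ENNReal.ofReal_mul (by positivity), ENNReal.ofReal_natCast]
  calc stdGaussian (Params n₀ n k) {θ | ¬ WellScaled C θ}
      ≤ ENNReal.ofReal ε + ENNReal.ofReal ε + ENNReal.ofReal (k * ε) +
          ENNReal.ofReal (k * ε) + ENNReal.ofReal ε := by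
        refine (measure_mono hsub).trans ?_
        refine (measure_union_le _ _).trans (add_le_add ?_ (hvec _))
        refine (measure_union_le _ _).trans (add_le_add ?_ (hunion _ fun ℓ => hvec _))
        refine (measure_union_le _ _).trans (add_le_add ?_ (hunion _ hmat))
        exact (measure_union_le _ _).trans (add_le_add hin (hvec _))
    _ = ENNReal.ofReal δ := by
        have hkε : 0 ≤ k * ε := by positivity
        rw [← ENNReal.ofReal_add hε0.le hε0.le, ← ENNReal.ofReal_add (by positivity) hkε,
          ← ENNReal.ofReal_add (by positivity) hkε, ← ENNReal.ofReal_add (by positivity) hε0.le]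
        congr 1
        rw [hε]
        field_simp
        ring

end TrainingFree

/-- The parameters `θ` are drawn from the standard Gaussian law on `ℝ^d`.  An event has probability
at least `1 - δ` in the form: its complement has (outer) measure at most `δ`. The constants
`ρ₁, ρ₂` do not depend on the width `n`, on the loss or on the labels. -/
theorem theorem1 {Y : Type*} (n₀ k m : ℕ) (hn₀ : 0 < n₀) (hm : 0 < m)
    (σ : ℝ → ℝ) (τ : ℝ)
    (hσ_lip : ∃ K : ℝ≥0, LipschitzWith K σ)
    (hσ_diff : Differentiable ℝ σ) (hσ_diff2 : Differentiable ℝ (deriv σ))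
    (hσ_bdd : ∃ B : ℝ, ∀ z, |deriv (deriv σ) z| ≤ B)
    (x : Fin m → EuclideanSpace ℝ (Fin n₀))
    (δ : ℝ) (hδ0 : 0 < δ) (hδ1 : δ < 1) :
    ∃ ρ₁ ρ₂ : ℝ, 0 < ρ₁ ∧ 0 < ρ₂ ∧
      ∀ (n : ℕ), 0 < n →
      ∀ (β γ : ℝ≥0) (loss : ℝ → Y → ℝ),
        (∀ y, LipschitzWith β (fun u => loss u y)) →
        (∀ y, Differentiable ℝ (fun u => loss u y)) →
        (∀ y, LipschitzWith γ (deriv (fun u => loss u y))) →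
      ∀ (y : Fin m → Y),
        let f := TrainingFree.model σ τ n k x
        let d := TrainingFree.numParams n₀ n k
        let P := stdGaussian (TrainingFree.Params n₀ n k)
        -- the derivatives in the definitions of the metrics exist
        (∀ i θ, DifferentiableAt ℝ (f i) θ ∧
          DifferentiableAt ℝ (TrainingFree.sampleLoss loss f y i) θ ∧
          (DifferentiableAt ℝ (deriv (fun u => loss u (y i))) (f i θ) →
            DifferentiableAt ℝ (∇ (TrainingFree.sampleLoss loss f y i)) θ)) ∧
        -- `M_Grad`, for every initialization
        (∀ θ, TrainingFree.mGrad loss f y θ ≤ β * TrainingFree.mTrace f θ) ∧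
        -- `M_SNIP`, with probability at least `1 - δ`
        P {θ | ¬ (TrainingFree.mSNIP loss f y θ ≤
            β * TrainingFree.radius d δ * TrainingFree.mTrace f θ)} ≤ ENNReal.ofReal δ ∧
        -- all three metrics simultaneously, with probability at least `1 - δ`
        P {θ | ¬ (TrainingFree.mGrad loss f y θ ≤ β * TrainingFree.mTrace f θ ∧
            TrainingFree.mSNIP loss f y θ ≤
              β * TrainingFree.radius d (δ / 2) * TrainingFree.mTrace f θ ∧
            TrainingFree.mGraSP loss f y θ ≤
              β * (γ * ρ₁ ^ 2 + β * ρ₂) * TrainingFree.radius d (δ / 2) *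
                TrainingFree.mTrace f θ)} ≤ ENNReal.ofReal δ := by
  obtain ⟨K, hK⟩ := hσ_lip
  obtain ⟨B, hB⟩ := hσ_bdd
  obtain ⟨C, hC⟩ := TrainingFree.exists_wellScaled n₀ k (half_pos hδ0) (by linarith : δ / 2 < 1)
  obtain ⟨X, hX⟩ : ∃ X : ℝ, ∀ i, ‖x i‖ ≤ X :=
    ⟨∑ i, ‖x i‖, fun i => Finset.single_le_sum (f := fun i => ‖x i‖)
      (fun _ _ => norm_nonneg _) (Finset.mem_univ i)⟩
  obtain ⟨a₁, a₂, ha⟩ :=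
    TrainingFree.exists_bounds_net hK hσ_diff hσ_diff2 hB τ C X hn₀ k
  refine ⟨max a₁ 0 + 1, max a₂ 0 + 1, by positivity, by positivity, ?_⟩
  intro n hn β γ loss hl_lip hl_diff hl_deriv y f d P
  have hjet : ∀ i θ, ∃ b₁ b₂, TrainingFree.BoundedJet (f i) θ b₁ b₂ := by
    intro i θ
    obtain ⟨b₁, b₂, hb⟩ :=
      TrainingFree.exists_bounds_net hK hσ_diff hσ_diff2 hB τ ‖θ‖ X hn₀ k
    exact ⟨b₁, b₂, hb n hn (x i) (hX i) θ (TrainingFree.wellScaled_norm hn θ)⟩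
  have hf : ∀ i, Differentiable ℝ (f i) := fun i => by
    obtain ⟨_, _, h⟩ := hjet i 0
    exact h.diff
  have hf' : ∀ i, Differentiable ℝ (∇ (f i)) := fun i => by
    obtain ⟨_, _, h⟩ := hjet i 0
    exact h.differentiable_gradient
  have hGrad := TrainingFree.mGrad_le hl_lip hl_diff hf y
  refine ⟨fun i θ => ⟨hf i θ, (TrainingFree.sampleLoss_hasGradientAt (hl_diff _)
    (hf i θ)).differentiableAt, TrainingFree.differentiableAt_gradient_sampleLoss hl_diff hf
    (hf' i θ)⟩, hGrad, ?_, ?_⟩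
  · refine (measure_mono fun θ hθ => ?_).trans (TrainingFree.measure_radius_lt_norm_le hδ0 hδ1)
    by_contra hcon
    exact hθ (TrainingFree.mSNIP_le hl_lip hl_diff hf y (not_lt.1 hcon))
  · have hsub : {θ | ¬ (TrainingFree.mGrad loss f y θ ≤ β * TrainingFree.mTrace f θ ∧
          TrainingFree.mSNIP loss f y θ ≤
            β * TrainingFree.radius d (δ / 2) * TrainingFree.mTrace f θ ∧
          TrainingFree.mGraSP loss f y θ ≤
            β * (γ * (max a₁ 0 + 1) ^ 2 + β * (max a₂ 0 + 1)) *
              TrainingFree.radius d (δ / 2) * TrainingFree.mTrace f θ)} ⊆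
        {θ | TrainingFree.radius d (δ / 2) < ‖θ‖} ∪ {θ | ¬ TrainingFree.WellScaled C θ} := by
      intro θ hθ
      by_contra hcon
      rw [Set.mem_union, not_or] at hcon
      have hr : ‖θ‖ ≤ TrainingFree.radius d (δ / 2) := not_lt.1 hcon.1
      have hj : ∀ i, TrainingFree.BoundedJet (f i) θ a₁ a₂ := fun i =>
        ha n hn (x i) (hX i) θ (not_not.1 hcon.2)
      -- `mGraSP_le` needs strict bounds, whence the summand `1` in the constants.
      refine hθ ⟨hGrad θ, TrainingFree.mSNIP_le hl_lip hl_diff hf y hr,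
        TrainingFree.mGraSP_le hl_lip hl_diff hl_deriv hf (fun i => hf' i θ) y (by positivity)
          (fun i => ?_) (fun i => ?_) hr⟩
      · linarith [(hj i).norm_gradient_le, le_max_left a₁ 0]
      · linarith [(hj i).norm_fderiv_gradient_le, le_max_left a₂ 0]
    calc P _ ≤ P ({θ | TrainingFree.radius d (δ / 2) < ‖θ‖} ∪
          {θ | ¬ TrainingFree.WellScaled C θ}) := measure_mono hsub
      _ ≤ ENNReal.ofReal (δ / 2) + ENNReal.ofReal (δ / 2) :=
          (measure_union_le _ _).trans (add_le_add
            (TrainingFree.measure_radius_lt_norm_le (half_pos hδ0) (by linarith)) (hC n hn))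
      _ = ENNReal.ofReal δ := by
          rw [← ENNReal.ofReal_add (by positivity) (by positivity), add_halves]
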